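/- Let $N\ge 2$ be an integer, $c>0$, $R>0$, and let $f:[0,\infty)\to\mathbb{R}$ be continuous at $0$ and differentiable at $R$. Consider $N+1$ vortices $z_1,\dots,z_{N+1}\in\mathbb{C}$ governed by $$\dot z_j = i f(|z_j|)z_j + ic\sum_{k\ne j}\frac{z_j-z_k}{|z_j-z_k|^2},\qquad j=1,\dots,N+1, \qquad (1)$$ and the configuration $\xi=(\xi_1,\dots,\xi_{N+1})$ with $\xi_j=Re^{2\pi i j/N}$ for $1\le j\le N$ and $\xi_{N+1}=0$ ($N$ vortices on a ring of radius $R$ and one at the center). (a) For $\omega\in\mathbb{R}$, $z(t)=e^{i\omega t}\xi$ is a solution of (1) (a relative equilibrium) if and only if $$\omega=f(R)+\frac{c(N+1)}{2R^2}.$$ For this $\omega$, consider the associated aggregation equation $$\dot x_j=(f(|x_j|)-\omega)x_j+c\sum_{k\ne j}\frac{x_j-x_k}{|x_j-x_k|^2},\qquad j=1,\dots,N+1. \qquad (2)$$ Call $\xi$ *stable* for (2) if it is an equilibrium of (2) and all eigenvalues of the linearization of (2) at $\xi$ have negative real part, except for one algebraically simple eigenvalue $0$, whose eigenvector is the infinitesimal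 rotation $i\xi$. Call the relative equilibrium $e^{i\omega t}\xi$ *neutrally stable* for (1) if all eigenvalues of the linearization of (1) at $\xi$, in the frame rotating with angular velocity $\omega$, are purely imaginary. Let $$\lambda_+(m)=f'(R)R+\frac{c}{2R^2}\bigl[(m-1)(N-m-1)-(N-1)\bigr],\qquad \lambda_+^*(m)=\lambda_+(m)-\frac{2c}{R^2},$$ $$M_0=\begin{pmatrix} f'(R)\frac R2-\frac{c(N+1)}{2R^2} & f'(R)\frac R2-\frac{c}{R^2} & \frac{c}{R^2}\\ f'(R)\frac R2-\frac{c}{R^2} & f'(R)\frac R2-\frac{c(N+1)}{2R^2} & 0\\ \frac{cN}{R^2} & 0 & f(0)-f(R)-\frac{c(N+1)}{2R^2}\end{pmatrix}.$$ (b) If $N\ge3$, then the $N+1$ configuration $\xi$ is stable for (2) if and only if $\lambda_+^*(\lfloor N/2\rfloor)<0$ and all eigenvalues of $M_0$ are negative. If $N=2$, these two conditions are necessary for stability. (c) If $\xi$ is stable for (2), then the relative equilibrium $e^{i\omega t}\xi$ is neutrally stable for (1). -/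

import Mathlib

noncomputable section

namespace Vortex

/-- The right-hand side of the vortex equation
`z_j' = i f(|z_j|) z_j + i c ∑_{k ≠ j} (z_j - z_k) / |z_j - z_k|²`,
for vortices labelled by a finite type `ι`. -/
def vortexField {ι : Type*} [Fintype ι] [DecidableEq ι] (f : ℝ → ℝ) (c : ℝ)
    (z : ι → ℂ) : ι → ℂ := fun j =>
  Complex.I * (f ‖z j‖ : ℂ) * z j
    + Complex.I * (c : ℂ) *
      ∑ k ∈ Finset.univ.erase j, (z j - z k) / ((‖z j - z k‖ ^ 2 : ℝ) : ℂ)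

/-- `z` is a solution, for all times, of the vortex equation. -/
def IsVortexSolution {ι : Type*} [Fintype ι] [DecidableEq ι] (f : ℝ → ℝ) (c : ℝ)
    (z : ℝ → ι → ℂ) : Prop :=
  ∀ (t : ℝ) (j : ι), HasDerivAt (fun s => z s j) (vortexField f c (z t) j) t

/-- The vortex equation in the frame rotating with angular velocity `ω`: `z_j(t) = e^{iωt} x_j(t)`
solves the vortex equation iff `x` solves `x_j' = (rotatingVortexField f c ω x)_j`. -/
def rotatingVortexField {ι : Type*} [Fintype ι] [DecidableEq ι] (f : ℝ → ℝ) (c ω : ℝ)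
    (x : ι → ℂ) : ι → ℂ := fun j =>
  vortexField f c x j - Complex.I * (ω : ℂ) * x j

/-- The right-hand side of the aggregation equation
`x_j' = (f(|x_j|) - ω) x_j + c ∑_{k ≠ j} (x_j - x_k) / |x_j - x_k|²`. -/
def aggregationField {ι : Type*} [Fintype ι] [DecidableEq ι] (f : ℝ → ℝ) (c ω : ℝ)
    (x : ι → ℂ) : ι → ℂ := fun j =>
  ((f ‖x j‖ - ω : ℝ) : ℂ) * x j
    + (c : ℂ) * ∑ k ∈ Finset.univ.erase j, (x j - x k) / ((‖x j - x k‖ ^ 2 : ℝ) : ℂ)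

/-- The `N + 1` configuration: `N` vortices at the vertices of a regular polygon of radius `R`
centred at the origin, and one vortex (labelled `none`) at the origin. -/
def ringPlusCenter (N : ℕ) (R : ℝ) : Option (Fin N) → ℂ
  | some j => (R : ℂ) * Complex.exp (2 * (Real.pi : ℂ) * Complex.I * ((j : ℕ) : ℂ) / (N : ℂ))
  | none => 0

/-- The `N + 1` configuration rotating rigidly with angular velocity `ω`. -/
def rotatingRingPlusCenter (N : ℕ) (R ω : ℝ) (t : ℝ) : Option (Fin N) → ℂ := fun j =>
  Complex.exp (Complex.I * (ω : ℂ) * (t : ℂ)) * ringPlusCenter N R j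

/-- `μ : ℂ` is an eigenvalue (of the complexification) of the real-linear map `A`. -/
def IsComplexEigenvalue {V : Type*} [AddCommGroup V] [Module ℝ V] (A : V →ₗ[ℝ] V)
    (μ : ℂ) : Prop :=
  Module.End.HasEigenvalue (A.baseChange ℂ) μ

/-- The infinitesimal rotation `d/dθ (e^{iθ} x)` at `θ = 0`. -/
def rotationMode {ι : Type*} (x : ι → ℂ) : ι → ℂ := fun j => Complex.I * x j

/-- Linear (asymptotic) stability, modulo rotations, of an equilibrium `x` of a rotation-invariant
vector field `F`: all eigenvalues of the linearization of `F` at `x` have negative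
real part, except for the eigenvalue `0` forced by rotation invariance, which is algebraically
simple. -/
def IsLinearlyStable {ι : Type*} [Fintype ι] (F : (ι → ℂ) → (ι → ℂ)) (x : ι → ℂ) : Prop :=
  F x = 0 ∧ ∃ A : (ι → ℂ) →L[ℝ] (ι → ℂ), HasFDerivAt F A x ∧
    (∀ μ : ℂ, IsComplexEigenvalue (A : (ι → ℂ) →ₗ[ℝ] (ι → ℂ)) μ → μ.re < 0 ∨ μ = 0) ∧
    Module.End.maxGenEigenspace (A : (ι → ℂ) →ₗ[ℝ] (ι → ℂ)) 0
      = Submodule.span ℝ {rotationMode x}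

/-- Neutral linear stability of an equilibrium `x` of `F`: all eigenvalues of
the linearization of `F` at `x` are purely imaginary. -/
def IsNeutrallyStable {ι : Type*} [Fintype ι] (F : (ι → ℂ) → (ι → ℂ)) (x : ι → ℂ) : Prop :=
  F x = 0 ∧ ∃ A : (ι → ℂ) →L[ℝ] (ι → ℂ), HasFDerivAt F A x ∧
    ∀ μ : ℂ, IsComplexEigenvalue (A : (ι → ℂ) →ₗ[ℝ] (ι → ℂ)) μ → μ.re = 0

/-- `λ₊(m) = f'(R) R + c / (2 R²) * ((m - 1) (N - m - 1) - (N - 1))`. -/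
def lambdaPlus (f : ℝ → ℝ) (c R : ℝ) (N m : ℕ) : ℝ :=
  deriv f R * R
    + c / (2 * R ^ 2) * (((m : ℝ) - 1) * ((N : ℝ) - (m : ℝ) - 1) - ((N : ℝ) - 1))

/-- `λ₊*(m) = λ₊(m) - 2 c / R²`. -/
def lambdaPlusStar (f : ℝ → ℝ) (c R : ℝ) (N m : ℕ) : ℝ :=
  lambdaPlus f c R N m - 2 * c / R ^ 2

/-- The matrix `M₀` coupling the first ring mode to the central vortex. -/
def M0 (f : ℝ → ℝ) (c R : ℝ) (N : ℕ) : Matrix (Fin 3) (Fin 3) ℝ :=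
  !![deriv f R * (R / 2) - c * ((N : ℝ) + 1) / (2 * R ^ 2), deriv f R * (R / 2) - c / R ^ 2,
      c / R ^ 2;
    deriv f R * (R / 2) - c / R ^ 2, deriv f R * (R / 2) - c * ((N : ℝ) + 1) / (2 * R ^ 2),
      0;
    c * (N : ℝ) / R ^ 2, 0, f 0 - f R - c * ((N : ℝ) + 1) / (2 * R ^ 2)]

/-- All (complex) eigenvalues of the real square matrix `M` are negative real numbers. -/
def AllEigenvaluesNegative {n : Type*} [Fintype n] [DecidableEq n] (M : Matrix n n ℝ) : Prop :=
  ∀ μ ∈ spectrum ℂ (M.map (fun a : ℝ => (a : ℂ))), μ.im = 0 ∧ μ.re < 0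

/-- The stability criterion for the `N + 1` configuration: `λ₊*(⌊N/2⌋) < 0`, and all eigenvalues
of `M₀` are negative. -/
def StabilityCriterion (f : ℝ → ℝ) (c R : ℝ) (N : ℕ) : Prop :=
  lambdaPlusStar f c R N (N / 2) < 0 ∧ AllEigenvaluesNegative (M0 f c R N)

end Vortex

end

/-! View perturbations of ξ as a real Euclidean space under `realDot`. Since x/|x|² = 1/conj x, the
linearization A of (2) is only real-linear, but it is symmetric, as for a gradient flow. Stability
therefore means that ⟨h, Ah⟩ ≤ 0 with equality only on infinitesimal rotations.

Ring perturbations are analysed by discrete Fourier transform. With E the vertex as a root of unity,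
h ↦ E² conj h exchanges the modes E^(m+1) and E^(N-m+1), and root-of-unity sums show that A acts on
this pair as a symmetric 2×2 block with eigenvalues β + γ = λ₊*(m) and β - γ = -c m(N-m)/(2R²). The
first is largest at m = ⌊N/2⌋; the second is negative for 0 < m < N and zero at m = 0, which is the
rotation. For N ≥ 3 only the pair m = 1, which contains E^N = 1 (translation of the ring), couples
to the center, and this coupling is M₀. For N = 2 also E² = 1, so extra resonant terms appear. They
cancel when the form is added over two suitable test vectors, so necessity survives; the
mode-by-mode proof of sufficiency does not.

For (c), the linearization of (1) is iA. As ⟨Ah, iAh⟩ = 0, the linear flow conserves ⟨h, Ah⟩; this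
form is semidefinite and its null vectors lie in ker A, so no eigenvalue has nonzero real part. -/

namespace Vortex

open scoped ComplexConjugate TensorProduct

/-! ### Complex eigenvalues of real operators -/

noncomputable section ComplexEigenvalues

variable {V : Type*} [AddCommGroup V] [Module ℝ V]

/-- The real part of an element of the complexification `ℂ ⊗ V`. -/
def tensorRe : ℂ ⊗[ℝ] V →ₗ[ℝ] V :=
  (TensorProduct.lid ℝ V).toLinearMap ∘ₗ LinearMap.rTensor V Complex.reLm

/-- The imaginary part of an element of the complexification `ℂ ⊗ V`. -/
def tensorIm : ℂ ⊗[ℝ] V →ₗ[ℝ] V :=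
  (TensorProduct.lid ℝ V).toLinearMap ∘ₗ LinearMap.rTensor V Complex.imLm

@[simp] lemma tensorRe_tmul (z : ℂ) (v : V) : tensorRe (z ⊗ₜ[ℝ] v) = z.re • v := by
  simp [tensorRe]

@[simp] lemma tensorIm_tmul (z : ℂ) (v : V) : tensorIm (z ⊗ₜ[ℝ] v) = z.im • v := by
  simp [tensorIm]

lemma tmul_re_add_tmul_im (t : ℂ ⊗[ℝ] V) :
    (1 : ℂ) ⊗ₜ[ℝ] tensorRe t + Complex.I ⊗ₜ[ℝ] tensorIm t = t := by
  induction t with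
  | zero => simp
  | add x y hx hy =>
    simp only [map_add, TensorProduct.tmul_add]
    nth_rewrite 3 [← hx]
    nth_rewrite 3 [← hy]
    abel
  | tmul z v =>
    rw [tensorRe_tmul, tensorIm_tmul, ← TensorProduct.smul_tmul, ← TensorProduct.smul_tmul,
      ← TensorProduct.add_tmul]
    congr 1
    apply Complex.ext <;> simp

lemma tensorRe_smul (μ : ℂ) (t : ℂ ⊗[ℝ] V) :
    tensorRe (μ • t) = μ.re • tensorRe t - μ.im • tensorIm t := by
  induction t with
  | zero => simp
  | add x y hx hy => simp only [smul_add, map_add, hx, hy]; abel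
  | tmul z v => simp [TensorProduct.smul_tmul', sub_smul, mul_smul]

lemma tensorIm_smul (μ : ℂ) (t : ℂ ⊗[ℝ] V) :
    tensorIm (μ • t) = μ.im • tensorRe t + μ.re • tensorIm t := by
  induction t with
  | zero => simp
  | add x y hx hy => simp only [smul_add, map_add, hx, hy]; abel
  | tmul z v => simp [TensorProduct.smul_tmul', add_smul, mul_smul, add_comm]

lemma tensorRe_baseChange (A : V →ₗ[ℝ] V) (t : ℂ ⊗[ℝ] V) :
    tensorRe (A.baseChange ℂ t) = A (tensorRe t) := by
  induction t with
  | zero => simp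
  | add x y hx hy => simp [hx, hy]
  | tmul z v => simp

lemma tensorIm_baseChange (A : V →ₗ[ℝ] V) (t : ℂ ⊗[ℝ] V) :
    tensorIm (A.baseChange ℂ t) = A (tensorIm t) := by
  induction t with
  | zero => simp
  | add x y hx hy => simp [hx, hy]
  | tmul z v => simp

/-- Split a complex eigenvector as p + iq and compare real and imaginary parts; later arguments can
then stay in `V`. -/
lemma IsComplexEigenvalue.exists_re_im {A : V →ₗ[ℝ] V} {μ : ℂ} (h : IsComplexEigenvalue A μ) :
    ∃ p q : V, (p ≠ 0 ∨ q ≠ 0) ∧ A p = μ.re • p - μ.im • q ∧ A q = μ.im • p + μ.re • q := by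
  obtain ⟨t, ht⟩ := Module.End.HasEigenvalue.exists_hasEigenvector h
  have hA : A.baseChange ℂ t = μ • t := ht.apply_eq_smul
  refine ⟨tensorRe t, tensorIm t, ?_, ?_, ?_⟩
  · by_contra! h0
    apply ht.2
    rw [← tmul_re_add_tmul_im t, h0.1, h0.2]
    simp
  · rw [← tensorRe_baseChange, hA, tensorRe_smul]
  · rw [← tensorIm_baseChange, hA, tensorIm_smul]

lemma isComplexEigenvalue_of_apply_eq_smul {A : V →ₗ[ℝ] V} {l : ℝ} {v : V} (hv : v ≠ 0)
    (h : A v = l • v) : IsComplexEigenvalue A (l : ℂ) := by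
  refine Module.End.hasEigenvalue_of_hasEigenvector (x := (1 : ℂ) ⊗ₜ[ℝ] v) ⟨?_, ?_⟩
  · rw [Module.End.mem_eigenspace_iff, LinearMap.baseChange_tmul, h,
      ← TensorProduct.smul_tmul, TensorProduct.smul_tmul']
    simp
  · intro h0
    apply hv
    have := congrArg tensorRe h0
    simpa using this

end ComplexEigenvalues

/-! ### Symmetric operators, and i times a semidefinite one -/

noncomputable section SymmetricOperators

variable {ι : Type*} [Fintype ι]

/-- The real part of the standard Hermitian inner product on `ι → ℂ`. -/
def realDot (x y : ι → ℂ) : ℝ := ∑ j, (conj (x j) * y j).re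

lemma realDot_comm (x y : ι → ℂ) : realDot x y = realDot y x :=
  Finset.sum_congr rfl fun j _ => by simp; ring

lemma realDot_add_right (x y z : ι → ℂ) : realDot x (y + z) = realDot x y + realDot x z := by
  simp [realDot, mul_add, Finset.sum_add_distrib]

lemma realDot_sub_right (x y z : ι → ℂ) : realDot x (y - z) = realDot x y - realDot x z := by
  simp only [realDot, Pi.sub_apply, mul_sub, Complex.sub_re, Finset.sum_sub_distrib]

lemma realDot_smul_right (r : ℝ) (x y : ι → ℂ) : realDot x (r • y) = r * realDot x y := by
  simp only [realDot, Pi.smul_apply, Finset.mul_sum]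
  refine Finset.sum_congr rfl fun j _ => ?_
  simp
  ring

lemma realDot_zero_right (x : ι → ℂ) : realDot x 0 = 0 := by simp [realDot]

lemma realDot_self_nonneg (x : ι → ℂ) : 0 ≤ realDot x x :=
  Finset.sum_nonneg fun j _ => by
    simp only [Complex.mul_re, Complex.conj_re, Complex.conj_im]
    nlinarith [mul_self_nonneg (x j).re, mul_self_nonneg (x j).im]

lemma eq_zero_of_realDot_self_eq_zero {x : ι → ℂ} (h : realDot x x = 0) : x = 0 := by
  rw [realDot, Finset.sum_eq_zero_iff_of_nonneg] at h
  · funext j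
    have := h j (Finset.mem_univ j)
    simp only [Complex.mul_re, Complex.conj_re, Complex.conj_im] at this
    apply Complex.ext
    · simp only [Pi.zero_apply, Complex.zero_re]
      nlinarith [mul_self_nonneg (x j).re, mul_self_nonneg (x j).im]
    · simp only [Pi.zero_apply, Complex.zero_im]
      nlinarith [mul_self_nonneg (x j).re, mul_self_nonneg (x j).im]
  · intro j _
    simp only [Complex.mul_re, Complex.conj_re, Complex.conj_im]
    nlinarith [mul_self_nonneg (x j).re, mul_self_nonneg (x j).im]

/-- Symmetry of a real-linear operator on `ι → ℂ` with respect to `realDot`. -/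
def IsRealSymmetric (A : (ι → ℂ) →ₗ[ℝ] (ι → ℂ)) : Prop :=
  ∀ x y, realDot (A x) y = realDot x (A y)

variable {A : (ι → ℂ) →ₗ[ℝ] (ι → ℂ)}

/-- The complex eigenvalues of a symmetric operator are real, with real eigenvectors. -/
lemma IsRealSymmetric.exists_eigenvector (hA : IsRealSymmetric A) {μ : ℂ}
    (h : IsComplexEigenvalue A μ) : μ.im = 0 ∧ ∃ v, v ≠ 0 ∧ A v = μ.re • v := by
  obtain ⟨p, q, hpq, hp, hq⟩ := h.exists_re_im
  have h1 := hA p q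
  rw [hp, hq, realDot_comm, realDot_sub_right, realDot_add_right] at h1
  simp only [realDot_smul_right] at h1
  rw [realDot_comm q p] at h1
  have hpos : 0 < realDot p p + realDot q q := by
    have h2 := realDot_self_nonneg p
    have h3 := realDot_self_nonneg q
    rcases hpq with h0 | h0
    · have := h2.lt_of_ne' fun h => h0 (eq_zero_of_realDot_self_eq_zero h)
      linarith
    · have := h3.lt_of_ne' fun h => h0 (eq_zero_of_realDot_self_eq_zero h)
      linarith
  have him : μ.im = 0 := by
    have : μ.im * (realDot p p + realDot q q) = 0 := by linarith
    exact (mul_eq_zero.1 this).resolve_right hpos.ne'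
  refine ⟨him, ?_⟩
  rw [him, zero_smul] at hp hq
  rcases hpq with h0 | h0
  · exact ⟨p, h0, by simpa using hp⟩
  · exact ⟨q, h0, by simpa using hq⟩

/-- No Jordan blocks: A²v = 0 gives ⟨Av, Av⟩ = ⟨v, A²v⟩ = 0. Algebraic simplicity of 0 thus becomes
a statement about the kernel. -/
lemma IsRealSymmetric.maxGenEigenspace_zero (hA : IsRealSymmetric A) :
    Module.End.maxGenEigenspace A 0 = LinearMap.ker A := by
  have key : ∀ (k : ℕ) (v : ι → ℂ), (A ^ k) v = 0 → A v = 0 := by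
    intro k
    induction k with
    | zero => intro v hv; simp_all
    | succ k ih =>
      intro v hv
      have h1 : A (A v) = 0 := ih _ (by simpa [pow_succ] using hv)
      apply eq_zero_of_realDot_self_eq_zero
      rw [hA, h1, realDot_zero_right]
  ext v
  rw [Module.End.mem_maxGenEigenspace, LinearMap.mem_ker]
  constructor
  · rintro ⟨k, hk⟩
    exact key k v (by simpa using hk)
  · intro h
    exact ⟨1, by simpa using h⟩

/-- In an orthonormal eigenbasis the form is ∑ eᵢ wᵢ² with every eᵢ ≤ 0, so it vanishes only if each
eᵢ wᵢ does. The spectral theorem is applied on the `PiLp 2` copy, whose inner product is `realDot`.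
-/
lemma IsRealSymmetric.realDot_apply_self_nonpos (hA : IsRealSymmetric A)
    (h : ∀ (l : ℝ) (v : ι → ℂ), v ≠ 0 → A v = l • v → l ≤ 0) (v : ι → ℂ) :
    realDot v (A v) ≤ 0 ∧ (realDot v (A v) = 0 → A v = 0) := by
  let L : PiLp 2 (fun _ : ι => ℂ) ≃ₗ[ℝ] (ι → ℂ) := WithLp.linearEquiv 2 ℝ (ι → ℂ)
  let T : PiLp 2 (fun _ : ι => ℂ) →ₗ[ℝ] PiLp 2 (fun _ : ι => ℂ) :=
    L.symm.toLinearMap ∘ₗ A ∘ₗ L.toLinearMap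
  have hin : ∀ x y : PiLp 2 (fun _ : ι => ℂ), inner ℝ x y = realDot (L x) (L y) := by
    intro x y
    rw [PiLp.inner_apply, realDot]
    refine Finset.sum_congr rfl fun j _ => ?_
    rw [Complex.inner, mul_comm]
    rfl
  have hLT : ∀ x, L (T x) = A (L x) := fun x => by simp [T]
  have hT : T.IsSymmetric := fun x y => by rw [hin, hin, hLT, hLT, hA]
  set b := hT.eigenvectorBasis rfl with hb
  set e := hT.eigenvalues rfl with he
  have hTb : ∀ i, T (b i) = e i • b i := fun i => by
    exact hT.apply_eigenvectorBasis rfl i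
  have hle : ∀ i, e i ≤ 0 := fun i => by
    refine h (e i) (L (b i)) ?_ ?_
    · intro h0
      exact b.orthonormal.ne_zero i (by simpa using h0)
    · rw [← hLT, hTb, map_smul]
  obtain ⟨w, rfl⟩ := L.surjective v
  have hcoef : ∀ i, inner ℝ (b i) (T w) = e i * inner ℝ (b i) w := fun i => by
    rw [← hT, hTb, real_inner_smul_left]
  have hsum : realDot (L w) (A (L w)) = ∑ i, e i * (inner ℝ (b i) w) ^ 2 := by
    rw [← hLT, ← hin, ← b.sum_inner_mul_inner w (T w)]
    refine Finset.sum_congr rfl fun i _ => ?_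
    rw [hcoef, real_inner_comm]
    ring
  have hterm : ∀ i, e i * (inner ℝ (b i) w) ^ 2 ≤ 0 := fun i =>
    mul_nonpos_of_nonpos_of_nonneg (hle i) (sq_nonneg _)
  refine ⟨hsum ▸ Finset.sum_nonpos fun i _ => hterm i, fun h0 => ?_⟩
  rw [hsum, Finset.sum_eq_zero_iff_of_nonpos fun i _ => hterm i] at h0
  have hTw : T w = 0 := by
    rw [← b.sum_repr' (T w)]
    refine Finset.sum_eq_zero fun i _ => ?_
    have := h0 i (Finset.mem_univ i)
    rw [hcoef]
    rcases mul_eq_zero.1 this with h1 | h1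
    · simp [h1]
    · simp [pow_eq_zero_iff (two_ne_zero) |>.1 h1]
  rw [← hLT, hTw, map_zero]

/-- If `A` is symmetric and negative semidefinite, then all eigenvalues of `i A` are imaginary. -/
lemma IsRealSymmetric.re_eq_zero_of_isComplexEigenvalue (hA : IsRealSymmetric A)
    (hneg : ∀ v, realDot v (A v) ≤ 0 ∧ (realDot v (A v) = 0 → A v = 0))
    {B : (ι → ℂ) →ₗ[ℝ] (ι → ℂ)} (hB : ∀ v j, B v j = Complex.I * A v j) {μ : ℂ}
    (h : IsComplexEigenvalue B μ) : μ.re = 0 := by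
  have hskew : ∀ v, realDot (A v) (B v) = 0 := fun v => by
    refine Finset.sum_eq_zero fun j _ => ?_
    rw [hB]
    simp
    ring
  obtain ⟨p, q, hpq, hp, hq⟩ := h.exists_re_im
  have h1 := hskew p
  have h2 := hskew q
  rw [hp, realDot_sub_right, realDot_smul_right, realDot_smul_right] at h1
  rw [hq, realDot_add_right, realDot_smul_right, realDot_smul_right] at h2
  have h3 : realDot (A p) q = realDot (A q) p := by rw [hA, realDot_comm]
  rw [hA p p] at h1
  rw [hA q q] at h2
  by_contra hre
  -- Add ⟨Ap, Bp⟩ = 0 and ⟨Aq, Bq⟩ = 0: the terms in Im μ cancel by symmetry of A.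
  have h4 : μ.re * (realDot p (A p) + realDot q (A q)) = 0 := by
    rw [h3] at h1
    linarith
  have h5 := (mul_eq_zero.1 h4).resolve_left hre
  have hAp : A p = 0 := (hneg p).2 (by linarith [(hneg p).1, (hneg q).1])
  have hAq : A q = 0 := (hneg q).2 (by linarith [(hneg p).1, (hneg q).1])
  have hBp : B p = 0 := funext fun j => by simp [hB, hAp]
  have hBq : B q = 0 := funext fun j => by simp [hB, hAq]
  rw [hBp] at hp
  rw [hBq] at hq
  have hn : μ.re ^ 2 + μ.im ^ 2 ≠ 0 := by positivity
  have e1 : (μ.re ^ 2 + μ.im ^ 2) • p = 0 := by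
    have : (μ.re ^ 2 + μ.im ^ 2) • p
        = μ.re • (μ.re • p - μ.im • q) + μ.im • (μ.im • p + μ.re • q) := by
      module
    rw [this, ← hp, ← hq]
    simp
  have e2 : (μ.re ^ 2 + μ.im ^ 2) • q = 0 := by
    have : (μ.re ^ 2 + μ.im ^ 2) • q
        = μ.re • (μ.im • p + μ.re • q) - μ.im • (μ.re • p - μ.im • q) := by
      module
    rw [this, ← hp, ← hq]
    simp
  rcases hpq with h0 | h0
  · exact h0 ((smul_eq_zero.1 e1).resolve_left hn)
  · exact h0 ((smul_eq_zero.1 e2).resolve_left hn)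

end SymmetricOperators

/-! ### Sums over nontrivial roots of unity -/

section RootSums

variable {κ : Type*} {s : Finset κ} {w : κ → ℂ} {N : ℕ}

/-- Telescoping with w^(k+1)/(1-w) = w^k/(1-w) - w^k: the step k = 0 subtracts N - 1, each later one
adds 1. -/
lemma sum_pow_mul_inv_one_sub (hN : 1 ≤ N) (h1 : ∀ i ∈ s, w i ≠ 1)
    (hcard : s.card = N - 1) (hH : ∑ i ∈ s, (1 - w i)⁻¹ = ((N : ℂ) - 1) / 2)
    (hsum : ∀ l : ℕ, 0 < l → l < N → ∑ i ∈ s, w i ^ l = -1) (k : ℕ) (hk : k + 1 ≤ N) :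
    ∑ i ∈ s, w i ^ (k + 1) * (1 - w i)⁻¹ = -((N : ℂ) - 1) / 2 + k := by
  have step : ∀ k : ℕ, ∑ i ∈ s, w i ^ (k + 1) * (1 - w i)⁻¹
      = ∑ i ∈ s, w i ^ k * (1 - w i)⁻¹ - ∑ i ∈ s, w i ^ k := by
    intro k
    rw [← Finset.sum_sub_distrib]
    refine Finset.sum_congr rfl fun i hi => ?_
    have : 1 - w i ≠ 0 := sub_ne_zero.2 (h1 i hi).symm
    field_simp
    ring
  induction k with
  | zero =>
    rw [step]
    simp only [pow_zero, one_mul, hH, Finset.sum_const, hcard, nsmul_eq_mul, mul_one]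
    push_cast [hN]
    ring
  | succ k ih =>
    rw [step, ih (by omega), hsum _ (by omega) (by omega)]
    push_cast
    ring

/-- The sum `∑ 1 / (1 - w)` over the nontrivial `N`-th roots of unity. -/
lemma sum_inv_one_sub (hN : 1 ≤ N) (h1 : ∀ i ∈ s, w i ≠ 1) (hw : ∀ i ∈ s, w i ^ N = 1)
    (hsum : ∀ l : ℕ, 0 < l → l < N → ∑ i ∈ s, w i ^ l = -1) :
    ∑ i ∈ s, (1 - w i)⁻¹ = ((N : ℂ) - 1) / 2 := by
  have hgeom : ∀ (z : ℂ) (n : ℕ), (1 - z) * ∑ l ∈ Finset.range n, (l : ℂ) * z ^ l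
      = ∑ l ∈ Finset.range n, z ^ l - 1 - ((n : ℂ) - 1) * z ^ n := by
    intro z n
    induction n with
    | zero => simp
    | succ n ih =>
      rw [Finset.sum_range_succ, Finset.sum_range_succ, mul_add, ih]
      push_cast
      ring
  have hN0 : (N : ℂ) ≠ 0 := by exact_mod_cast (by omega : N ≠ 0)
  -- For w^N = 1 and w ≠ 1, `hgeom` reads (1 - w) ∑ l w^l = -N.
  have hinv : ∀ i ∈ s, (1 - w i)⁻¹ = -(N : ℂ)⁻¹ * ∑ l ∈ Finset.range N, (l : ℂ) * w i ^ l := by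
    intro i hi
    have hne : 1 - w i ≠ 0 := sub_ne_zero.2 (h1 i hi).symm
    have h2 := hgeom (w i) N
    have h3 : ∑ l ∈ Finset.range N, w i ^ l = 0 := by
      have h4 := mul_neg_geom_sum (w i) N
      rw [hw i hi, sub_self] at h4
      exact (mul_eq_zero.1 h4).resolve_left hne
    rw [h3, hw i hi] at h2
    field_simp
    linear_combination h2
  rw [Finset.sum_congr rfl hinv, ← Finset.mul_sum, Finset.sum_comm]
  have h5 : ∑ l ∈ Finset.range N, ∑ i ∈ s, (l : ℂ) * w i ^ l
      = ∑ l ∈ Finset.range N, -(l : ℂ) := by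
    refine Finset.sum_congr rfl fun l hl => ?_
    rw [← Finset.mul_sum]
    rcases Nat.eq_zero_or_pos l with h0 | h0
    · simp [h0]
    · rw [hsum l h0 (Finset.mem_range.1 hl)]
      ring
  rw [h5, Finset.sum_neg_distrib]
  have h6 : (∑ l ∈ Finset.range N, (l : ℂ)) * 2 = (N : ℂ) * (N - 1) := by
    have := Finset.sum_range_id_mul_two N
    have h7 : ((∑ l ∈ Finset.range N, l : ℕ) : ℂ) * 2 = ((N * (N - 1) : ℕ) : ℂ) := by
      exact_mod_cast this
    push_cast [hN] at h7
    exact h7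
  field_simp
  linear_combination h6

/-- Raising k by one adds w^(k+1)/(1-w), already summed. The quadratic in k is the origin of the
m(N-m) in λ₊*. -/
lemma sum_one_sub_pow_div_sq (hN : 1 ≤ N) (h1 : ∀ i ∈ s, w i ≠ 1) (hw : ∀ i ∈ s, w i ^ N = 1)
    (hcard : s.card = N - 1)
    (hsum : ∀ l : ℕ, 0 < l → l < N → ∑ i ∈ s, w i ^ l = -1) (k : ℕ) (hk : k ≤ N) :
    ∑ i ∈ s, (1 - w i ^ (k + 1)) / (1 - w i) ^ 2 = (1 - (k : ℂ)) * (N - 1 - k) / 2 := by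
  have hH := sum_inv_one_sub hN h1 hw hsum
  induction k with
  | zero =>
    rw [← Finset.sum_congr rfl (fun i hi => ?_), hH]
    · push_cast; ring
    · have : 1 - w i ≠ 0 := sub_ne_zero.2 (h1 i hi).symm
      field_simp
      simp
  | succ k ih =>
    have h2 := sum_pow_mul_inv_one_sub hN h1 hcard hH hsum k hk
    have h3 : ∑ i ∈ s, (1 - w i ^ (k + 1 + 1)) / (1 - w i) ^ 2
        = ∑ i ∈ s, (1 - w i ^ (k + 1)) / (1 - w i) ^ 2
          + ∑ i ∈ s, w i ^ (k + 1) * (1 - w i)⁻¹ := by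
      rw [← Finset.sum_add_distrib]
      refine Finset.sum_congr rfl fun i hi => ?_
      have : 1 - w i ≠ 0 := sub_ne_zero.2 (h1 i hi).symm
      field_simp
      ring
    rw [h3, h2, ih (by omega)]
    push_cast
    ring

end RootSums

/-! ### Vertices of the polygon as roots of unity -/

noncomputable section UnitRoots

/-- The `N`-th roots of unity, indexed by `Fin N`. -/
def unitRoot (N : ℕ) (j : Fin N) : ℂ :=
  Complex.exp (2 * (Real.pi : ℂ) * Complex.I * ((j : ℕ) : ℂ) / (N : ℂ))

variable {N : ℕ}

lemma ringPlusCenter_some (R : ℝ) (j : Fin N) :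
    ringPlusCenter N R (some j) = (R : ℂ) * unitRoot N j := rfl

lemma ringPlusCenter_none (R : ℝ) : ringPlusCenter N R none = 0 := rfl

lemma unitRoot_eq_pow (j : Fin N) :
    unitRoot N j = Complex.exp (2 * Real.pi * Complex.I / N) ^ (j : ℕ) := by
  rw [unitRoot, ← Complex.exp_nat_mul]
  congr 1
  ring

lemma isPrimitiveRoot_exp_of_fin (j : Fin N) :
    IsPrimitiveRoot (Complex.exp (2 * Real.pi * Complex.I / N)) N :=
  Complex.isPrimitiveRoot_exp N (Nat.ne_of_gt j.pos)

lemma unitRoot_pow (j : Fin N) : unitRoot N j ^ N = 1 := by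
  rw [unitRoot_eq_pow, pow_right_comm, (isPrimitiveRoot_exp_of_fin j).pow_eq_one, one_pow]

lemma unitRoot_injective : Function.Injective (unitRoot N) := by
  intro j k h
  rw [unitRoot_eq_pow, unitRoot_eq_pow] at h
  exact Fin.ext ((isPrimitiveRoot_exp_of_fin j).pow_inj j.2 k.2 h)

lemma norm_unitRoot (j : Fin N) : ‖unitRoot N j‖ = 1 :=
  Complex.norm_eq_one_of_pow_eq_one (unitRoot_pow j) (Nat.ne_of_gt j.pos)

lemma unitRoot_mul_conj (j : Fin N) : unitRoot N j * conj (unitRoot N j) = 1 := by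
  rw [Complex.mul_conj, Complex.normSq_eq_norm_sq, norm_unitRoot]
  simp

lemma unitRoot_ne_zero (j : Fin N) : unitRoot N j ≠ 0 := by
  intro h
  simpa [h] using norm_unitRoot j

lemma conj_unitRoot_pow (j : Fin N) (l : ℕ) : conj (unitRoot N j) ^ l * unitRoot N j ^ l = 1 := by
  rw [← mul_pow, mul_comm, unitRoot_mul_conj, one_pow]

lemma sum_unitRoot_pow (l : ℕ) (hl : ¬ N ∣ l) : ∑ j : Fin N, unitRoot N j ^ l = 0 := by
  rcases Nat.eq_zero_or_pos N with rfl | hN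
  · simp
  set z := Complex.exp (2 * Real.pi * Complex.I / N) with hz
  have hprim : IsPrimitiveRoot z N := Complex.isPrimitiveRoot_exp N hN.ne'
  have h1 : ∑ j : Fin N, unitRoot N j ^ l = ∑ i ∈ Finset.range N, (z ^ l) ^ i := by
    rw [Finset.sum_range]
    refine Finset.sum_congr rfl fun j _ => ?_
    rw [unitRoot_eq_pow, pow_right_comm]
  have h2 := mul_neg_geom_sum (z ^ l) N
  rw [← pow_mul, mul_comm l N, pow_mul, hprim.pow_eq_one, one_pow, sub_self] at h2
  rw [h1]
  refine (mul_eq_zero.1 h2).resolve_left (sub_ne_zero.2 fun h => hl ?_)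
  exact (hprim.pow_eq_one_iff_dvd l).1 h.symm

lemma conj_unitRoot_mul_ne_one {j k : Fin N} (h : k ≠ j) :
    conj (unitRoot N k) * unitRoot N j ≠ 1 := by
  intro h1
  apply h
  apply unitRoot_injective
  have h2 := unitRoot_mul_conj k
  linear_combination (-unitRoot N k) * h1 + unitRoot N j * h2

lemma sum_erase_unitRoot_div_pow (j : Fin N) (l : ℕ) (hl : 0 < l) (hlN : l < N) :
    ∑ k ∈ Finset.univ.erase j, (conj (unitRoot N k) * unitRoot N j) ^ l = -1 := by
  have h1 : ∑ k : Fin N, (conj (unitRoot N k) * unitRoot N j) ^ l = 0 := by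
    simp only [mul_pow, ← map_pow]
    rw [← Finset.sum_mul, ← map_sum, sum_unitRoot_pow l (Nat.not_dvd_of_pos_of_lt hl hlN)]
    simp
  rw [← Finset.add_sum_erase _ _ (Finset.mem_univ j), mul_pow, conj_unitRoot_pow] at h1
  linear_combination h1

lemma conj_unitRoot_mul_pow (j k : Fin N) : (conj (unitRoot N k) * unitRoot N j) ^ N = 1 := by
  rw [mul_pow, ← map_pow, unitRoot_pow, unitRoot_pow]
  simp

/-- The equilibrium sum `∑_{k ≠ j} 1 / conj (e_j - e_k)` for the regular polygon. -/
lemma sum_inv_conj_sub (j : Fin N) :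
    ∑ k, (conj (unitRoot N j) - conj (unitRoot N k))⁻¹ = unitRoot N j * (((N : ℂ) - 1) / 2) := by
  have h := sum_inv_one_sub (N := N) (s := Finset.univ.erase j)
    (w := fun k => conj (unitRoot N k) * unitRoot N j) j.pos
    (fun k hk => conj_unitRoot_mul_ne_one (Finset.ne_of_mem_erase hk))
    (fun k _ => conj_unitRoot_mul_pow j k)
    (fun l h0 h1 => sum_erase_unitRoot_div_pow j l h0 h1)
  -- The term k = j of the full sum is 0⁻¹ = 0.
  rw [← Finset.add_sum_erase _ _ (Finset.mem_univ j), sub_self, inv_zero, zero_add, ← h,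
    Finset.mul_sum]
  refine Finset.sum_congr rfl fun k _ => ?_
  have : 1 - conj (unitRoot N k) * unitRoot N j
      = unitRoot N j * (conj (unitRoot N j) - conj (unitRoot N k)) := by
    linear_combination -unitRoot_mul_conj j
  rw [this, mul_inv, ← mul_assoc, mul_inv_cancel₀ (unitRoot_ne_zero j), one_mul]

/-- The Fourier modes diagonalize the Hessian of the polygon's interaction energy. -/
lemma sum_conj_pow_sub_div_sq (j : Fin N) (m : ℕ) (hm : m ≤ N) :
    ∑ k, (conj (unitRoot N j) ^ (m + 1) - conj (unitRoot N k) ^ (m + 1))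
        / (conj (unitRoot N j) - conj (unitRoot N k)) ^ 2
      = unitRoot N j ^ 2 * conj (unitRoot N j) ^ (m + 1)
        * ((1 - (m : ℂ)) * (N - 1 - m) / 2) := by
  have h := sum_one_sub_pow_div_sq (N := N) (s := Finset.univ.erase j)
    (w := fun k => conj (unitRoot N k) * unitRoot N j) j.pos
    (fun k hk => conj_unitRoot_mul_ne_one (Finset.ne_of_mem_erase hk))
    (fun k _ => conj_unitRoot_mul_pow j k) (by simp)
    (fun l h0 h1 => sum_erase_unitRoot_div_pow j l h0 h1) m hm
  rw [← Finset.add_sum_erase _ _ (Finset.mem_univ j), sub_self, zero_div, zero_add, ← h,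
    Finset.mul_sum]
  refine Finset.sum_congr rfl fun k hk => ?_
  have h1 : 1 - conj (unitRoot N k) * unitRoot N j
      = unitRoot N j * (conj (unitRoot N j) - conj (unitRoot N k)) := by
    linear_combination -unitRoot_mul_conj j
  have h2 : conj (unitRoot N j) ^ (m + 1) * (1 - (conj (unitRoot N k) * unitRoot N j) ^ (m + 1))
      = conj (unitRoot N j) ^ (m + 1) - conj (unitRoot N k) ^ (m + 1) := by
    rw [mul_pow]
    linear_combination (-conj (unitRoot N k) ^ (m + 1)) * conj_unitRoot_pow j (m + 1)
  have h3 := unitRoot_ne_zero j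
  rw [← h2, h1, mul_pow (unitRoot N j)]
  have h4 : conj (unitRoot N j) - conj (unitRoot N k) ≠ 0 := by
    rw [← map_sub]
    exact (map_ne_zero _).2 (sub_ne_zero.2 fun h =>
      (Finset.ne_of_mem_erase hk) (unitRoot_injective h.symm))
  field_simp

end UnitRoots

/-! ### Linearization of the aggregation equation -/

section Linearization

lemma div_norm_sq_eq_inv_conj (x : ℂ) : x / ((‖x‖ ^ 2 : ℝ) : ℂ) = (conj x)⁻¹ := by
  rw [← Complex.normSq_eq_norm_sq, ← Complex.mul_conj]
  rcases eq_or_ne x 0 with rfl | hx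
  · simp
  · have : conj x ≠ 0 := (map_ne_zero _).2 hx
    field_simp

/-- The map is inversion after conjugation, so its derivative is antilinear. -/
lemma hasFDerivAt_div_norm_sq {d : ℂ} (hd : d ≠ 0) :
    HasFDerivAt (fun x : ℂ => x / ((‖x‖ ^ 2 : ℝ) : ℂ))
      ((-((conj d) ^ 2)⁻¹) • (Complex.conjCLE : ℂ →L[ℝ] ℂ)) d := by
  have hd' : conj d ≠ 0 := (map_ne_zero _).2 hd
  have h1 : HasFDerivAt (fun x : ℂ => conj x) (Complex.conjCLE : ℂ →L[ℝ] ℂ) d :=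
    (Complex.conjCLE : ℂ →L[ℝ] ℂ).hasFDerivAt
  have h2 : HasFDerivAt (fun y : ℂ => y⁻¹)
      ((-((conj d) ^ 2)⁻¹) • ContinuousLinearMap.id ℝ ℂ) (conj d) := by
    have h3 := ((hasDerivAt_inv hd').hasFDerivAt).restrictScalars ℝ
    refine h3.congr_fderiv (ContinuousLinearMap.ext fun y => ?_)
    simp [mul_comm]
  have h3 := h2.comp d h1
  have h4 : (fun x : ℂ => x / ((‖x‖ ^ 2 : ℝ) : ℂ)) = (fun y : ℂ => y⁻¹) ∘ fun x : ℂ => conj x :=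
    funext div_norm_sq_eq_inv_conj
  rw [h4]
  refine h3.congr_fderiv (ContinuousLinearMap.ext fun y => ?_)
  simp

/-- The derivative of |x| is Re(conj x₀ · h)/R; writing Re as a half-sum produces the reflected term
in conj h. -/
lemma hasFDerivAt_radial_of_ne_zero {f : ℝ → ℝ} {R : ℝ} (hR : 0 < R)
    (hf : DifferentiableAt ℝ f R) (ω : ℝ) {x₀ : ℂ} (hx₀ : ‖x₀‖ = R) :
    ∃ L : ℂ →L[ℝ] ℂ, HasFDerivAt (fun x : ℂ => ((f ‖x‖ - ω : ℝ) : ℂ) * x) L x₀ ∧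
      ∀ h, L h = (f R - ω : ℂ) * h
        + (deriv f R * R / 2 : ℂ) * (h + (x₀ / R) ^ 2 * conj h) := by
  have hnorm : HasFDerivAt (fun x : ℂ => ‖x‖) (R⁻¹ • innerSL ℝ x₀) x₀ := by
    have h1 : HasFDerivAt (fun x : ℂ => ‖x‖ ^ 2) _ x₀ := (hasFDerivAt_id (𝕜 := ℝ) x₀).norm_sq
    have h2 := h1.sqrt (show ‖x₀‖ ^ 2 ≠ 0 by rw [hx₀]; positivity)
    simp only [id, Real.sqrt_sq (norm_nonneg _)] at h2
    refine h2.congr_fderiv (ContinuousLinearMap.ext fun y => ?_)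
    simp [hx₀]
    field_simp
  have hfd : HasDerivAt f (deriv f R) ‖x₀‖ := hx₀ ▸ hf.hasDerivAt
  have h1 := (hfd.comp_hasFDerivAt x₀ hnorm).sub_const ω
  have h2 := Complex.ofRealCLM.hasFDerivAt.comp x₀ h1
  have h3 := h2.mul (hasFDerivAt_id (𝕜 := ℝ) x₀)
  refine ⟨_, h3, fun h => ?_⟩
  have hRc : (R : ℂ) ≠ 0 := by exact_mod_cast hR.ne'
  have hc : x₀ * conj x₀ = (R : ℂ) ^ 2 := by
    rw [Complex.mul_conj, Complex.normSq_eq_norm_sq, hx₀]; push_cast; ring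
  have hin : ((inner ℝ x₀ h : ℝ) : ℂ) = (h * conj x₀ + conj h * x₀) / 2 := by
    rw [Complex.inner, Complex.re_eq_add_conj]; simp
  have hval : ∀ L : ℂ →L[ℝ] ℝ, L = deriv f R • R⁻¹ • innerSL ℝ x₀ →
      ((((fun x : ℂ => ((f ‖x‖ - ω : ℝ) : ℂ)) x₀) • ContinuousLinearMap.id ℝ ℂ
        + x₀ • (Complex.ofRealCLM.comp L)) : ℂ →L[ℝ] ℂ) h
      = (f R - ω : ℂ) * h + x₀ * (deriv f R * (R⁻¹ * ((inner ℝ x₀ h : ℝ) : ℂ))) := by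
    rintro L rfl
    simp only [add_apply, smul_apply, ContinuousLinearMap.comp_apply, Complex.ofRealCLM_apply,
      innerSL_apply_apply, hx₀, smul_eq_mul, ContinuousLinearMap.id_apply]
    push_cast
    ring
  refine (hval _ rfl).trans ?_
  rw [hin, Complex.ofReal_inv]
  field_simp
  linear_combination (deriv f R * h : ℂ) * hc

/-- One-sided continuity suffices, because (f(|x|) - f(0)) x = o(x). -/
lemma hasFDerivAt_radial_zero {f : ℝ → ℝ} (hf : ContinuousWithinAt f (Set.Ici 0) 0) (ω : ℝ) :
    HasFDerivAt (fun x : ℂ => ((f ‖x‖ - ω : ℝ) : ℂ) * x)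
      ((f 0 - ω) • ContinuousLinearMap.id ℝ ℂ) 0 := by
  rw [hasFDerivAt_iff_isLittleO_nhds_zero]
  have h1 : Filter.Tendsto (fun x : ℂ => ‖x‖) (nhds 0) (nhdsWithin 0 (Set.Ici 0)) := by
    refine tendsto_nhdsWithin_iff.2 ⟨?_, Filter.Eventually.of_forall fun x => norm_nonneg x⟩
    simpa using (continuous_norm (E := ℂ)).tendsto 0
  have h2 : Filter.Tendsto (fun x : ℂ => ((f ‖x‖ - f 0 : ℝ) : ℂ)) (nhds 0) (nhds 0) := by
    have h3 : Filter.Tendsto (fun x : ℂ => f ‖x‖ - f 0) (nhds 0) (nhds (f 0 - f 0)) :=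
      (Filter.Tendsto.comp hf h1).sub_const (f 0)
    rw [sub_self] at h3
    simpa [Function.comp_def] using (Complex.continuous_ofReal.tendsto 0).comp h3
  have h4 : (fun x : ℂ => ((f ‖x‖ - f 0 : ℝ) : ℂ) * x) =o[nhds 0] fun x : ℂ => (1 : ℂ) * x :=
    ((Asymptotics.isLittleO_one_iff ℂ).2 h2).mul_isBigO (Asymptotics.isBigO_refl _ _)
  refine (h4.congr (fun x => ?_) (fun x => one_mul x))
  simp
  ring

variable {N : ℕ}

lemma norm_ringPlusCenter_some {R : ℝ} (hR : 0 < R) (j : Fin N) :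
    ‖ringPlusCenter N R (some j)‖ = R := by
  rw [ringPlusCenter_some, norm_mul, norm_unitRoot, mul_one, Complex.norm_real,
    Real.norm_of_nonneg hR.le]

lemma ringPlusCenter_injective {R : ℝ} (hR : 0 < R) :
    Function.Injective (ringPlusCenter N R) := by
  have hRc : (R : ℂ) ≠ 0 := by exact_mod_cast hR.ne'
  intro j k h
  cases j with
  | none =>
    cases k with
    | none => rfl
    | some k =>
      have := norm_ringPlusCenter_some hR k
      rw [← h, ringPlusCenter_none, norm_zero] at this
      exact absurd this hR.ne
  | some j =>
    cases k with
    | none =>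
      have := norm_ringPlusCenter_some hR j
      rw [h, ringPlusCenter_none, norm_zero] at this
      exact absurd this hR.ne
    | some k =>
      rw [ringPlusCenter_some, ringPlusCenter_some] at h
      rw [unitRoot_injective (mul_left_cancel₀ hRc h)]

/-- The derivative is summed over all k, the term k = j being 0/0 = 0; this suits the Fourier sums.
-/
lemma hasFDerivAt_interaction {ι : Type*} [Fintype ι] [DecidableEq ι] (c : ℝ) {x : ι → ℂ}
    (hx : Function.Injective x) (j : ι) :
    ∃ L : (ι → ℂ) →L[ℝ] ℂ, HasFDerivAt (fun y : ι → ℂ => (c : ℂ) * ∑ k ∈ Finset.univ.erase j,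
        (y j - y k) / ((‖y j - y k‖ ^ 2 : ℝ) : ℂ)) L x ∧
      ∀ h, L h = -(c : ℂ) * ∑ k, (conj (h j) - conj (h k)) / (conj (x j) - conj (x k)) ^ 2 := by
  have h1 : ∀ k ∈ Finset.univ.erase j, HasFDerivAt
      (fun y : ι → ℂ => (y j - y k) / ((‖y j - y k‖ ^ 2 : ℝ) : ℂ))
      (((-((conj (x j - x k)) ^ 2)⁻¹) • (Complex.conjCLE : ℂ →L[ℝ] ℂ)).comp
        (ContinuousLinearMap.proj (R := ℝ) (φ := fun _ : ι => ℂ) j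
          - ContinuousLinearMap.proj (R := ℝ) (φ := fun _ : ι => ℂ) k)) x := by
    intro k hk
    have hne : x j - x k ≠ 0 := sub_ne_zero.2 (hx.ne (Finset.ne_of_mem_erase hk).symm)
    exact HasFDerivAt.comp x (hasFDerivAt_div_norm_sq hne)
      ((ContinuousLinearMap.proj (R := ℝ) (φ := fun _ : ι => ℂ) j
          - ContinuousLinearMap.proj (R := ℝ) (φ := fun _ : ι => ℂ) k).hasFDerivAt)
  refine ⟨_, (HasFDerivAt.fun_sum h1).const_smul (c : ℂ), fun h => ?_⟩
  rw [← Finset.add_sum_erase _ _ (Finset.mem_univ j), sub_self, zero_div, zero_add]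
  simp only [smul_apply, sum_apply, smul_eq_mul]
  rw [neg_mul, ← mul_neg, ← Finset.sum_neg_distrib]
  congr 1
  refine Finset.sum_congr rfl fun k _ => ?_
  simp
  ring

/-- The linearization of the aggregation equation at the `N + 1` configuration. -/
lemma exists_hasFDerivAt_aggregationField {f : ℝ → ℝ} {c R : ℝ} (hR : 0 < R)
    (hf0 : ContinuousWithinAt f (Set.Ici 0) 0) (hfR : DifferentiableAt ℝ f R) (ω : ℝ) :
    ∃ A : (Option (Fin N) → ℂ) →L[ℝ] (Option (Fin N) → ℂ),
      HasFDerivAt (aggregationField f c ω) A (ringPlusCenter N R) ∧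
      (∀ h, A h none = (f 0 - ω : ℂ) * h none
        - (c / R ^ 2 : ℂ) * ∑ k, unitRoot N k ^ 2 * (conj (h none) - conj (h (some k)))) ∧
      ∀ h j, A h (some j) = (f R - ω : ℂ) * h (some j)
        + (deriv f R * R / 2 : ℂ) * (h (some j) + unitRoot N j ^ 2 * conj (h (some j)))
        - (c / R ^ 2 : ℂ) *
          (∑ k, (conj (h (some j)) - conj (h (some k)))
              / (conj (unitRoot N j) - conj (unitRoot N k)) ^ 2
            + unitRoot N j ^ 2 * (conj (h (some j)) - conj (h none))) := by
  have hRc : (R : ℂ) ≠ 0 := by exact_mod_cast hR.ne'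
  choose I hI hIapply using
    hasFDerivAt_interaction (x := ringPlusCenter N R) c (ringPlusCenter_injective hR)
  choose L hL hLapply using fun j : Fin N =>
    hasFDerivAt_radial_of_ne_zero hR hfR ω (norm_ringPlusCenter_some (N := N) hR j)
  let D : Option (Fin N) → ℂ →L[ℝ] ℂ := fun j =>
    Option.elim j ((f 0 - ω) • ContinuousLinearMap.id ℝ ℂ) L
  have hD : ∀ j, HasFDerivAt (fun x : ℂ => ((f ‖x‖ - ω : ℝ) : ℂ) * x) (D j)
      (ringPlusCenter N R j) := by
    intro j
    cases j with
    | none => exact hasFDerivAt_radial_zero hf0 ω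
    | some j => exact hL j
  have hinv : ∀ k : Fin N, (conj (unitRoot N k) ^ 2)⁻¹ = unitRoot N k ^ 2 := fun k =>
    inv_eq_of_mul_eq_one_right (conj_unitRoot_pow k 2)
  refine ⟨ContinuousLinearMap.pi fun j =>
    (D j).comp (ContinuousLinearMap.proj (R := ℝ) (φ := fun _ : Option (Fin N) => ℂ) j) + I j,
    ?_, ?_, ?_⟩
  · refine hasFDerivAt_pi.2 fun j => ?_
    exact (HasFDerivAt.comp (ringPlusCenter N R) (hD j)
      (ContinuousLinearMap.proj (R := ℝ) (φ := fun _ : Option (Fin N) => ℂ) j).hasFDerivAt).add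
      (hI j)
  · intro h
    simp only [ContinuousLinearMap.coe_pi', add_apply,
      ContinuousLinearMap.comp_apply, ContinuousLinearMap.proj_apply, hIapply, D, Option.elim]
    rw [Fintype.sum_option, sub_self, zero_div, zero_add, sub_eq_add_neg _ ((c / R ^ 2 : ℂ) * _),
      neg_mul, div_mul_eq_mul_div, mul_div_assoc, Finset.sum_div]
    congr 1
    · simp
    · congr 2
      refine Finset.sum_congr rfl fun k _ => ?_
      rw [ringPlusCenter_none, ringPlusCenter_some, map_zero, zero_sub, neg_sq, map_mul, mul_pow,
        div_eq_mul_inv, mul_inv, hinv, Complex.conj_ofReal]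
      ring
  · intro h j
    simp only [ContinuousLinearMap.coe_pi', add_apply,
      ContinuousLinearMap.comp_apply, ContinuousLinearMap.proj_apply, hIapply, D, Option.elim,
      hLapply]
    rw [Fintype.sum_option, sub_eq_add_neg _ ((c / R ^ 2 : ℂ) * _), neg_mul,
      ringPlusCenter_some, mul_div_cancel_left₀ _ hRc]
    congr 2
    rw [ringPlusCenter_none, map_zero, sub_zero, map_mul, mul_pow, div_eq_mul_inv _ (_ * _),
      mul_inv, hinv, Complex.conj_ofReal, div_mul_eq_mul_div, mul_div_assoc, add_div,
      Finset.sum_div]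
    congr 1
    rw [add_comm]
    congr 1
    · refine Finset.sum_congr rfl fun k _ => ?_
      rw [ringPlusCenter_some, map_mul, Complex.conj_ofReal, ← mul_sub, mul_pow, div_div,
        mul_comm (_ ^ 2)]
    · ring

end Linearization

/-! ### Symmetry of the linearization and its action on Fourier modes -/

noncomputable section PolygonOperators

variable {N : ℕ} {κ α s : ℝ}

/-- The shape of the linearization of the aggregation equation at the `N + 1` configuration, in
terms of the coefficients `κ = f 0 - ω`, `α = f'(R) R / 2` and `s = c / R ^ 2`. -/
structure IsPolygonOperator (κ α s : ℝ)
    (A : (Option (Fin N) → ℂ) →ₗ[ℝ] (Option (Fin N) → ℂ)) : Prop where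
  apply_none : ∀ h, A h none = (κ : ℂ) * h none
    - (s : ℂ) * ∑ k, unitRoot N k ^ 2 * (conj (h none) - conj (h (some k)))
  apply_some : ∀ h j, A h (some j) = -((s : ℂ) * ((N : ℂ) + 1) / 2) * h (some j)
    + (α : ℂ) * (h (some j) + unitRoot N j ^ 2 * conj (h (some j)))
    - (s : ℂ) * (∑ k, (conj (h (some j)) - conj (h (some k)))
        / (conj (unitRoot N j) - conj (unitRoot N k)) ^ 2
      + unitRoot N j ^ 2 * (conj (h (some j)) - conj (h none)))

variable {A : (Option (Fin N) → ℂ) →ₗ[ℝ] (Option (Fin N) → ℂ)}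

lemma realDot_option (x y : Option (Fin N) → ℂ) :
    realDot x y = (conj (x none) * y none + ∑ j, conj (x (some j)) * y (some j)).re := by
  rw [realDot, Fintype.sum_option, Complex.add_re, Complex.re_sum]

lemma sum_interaction_symm (x y : Fin N → ℂ) :
    ∑ j, conj (x j) * ∑ k, (conj (y j) - conj (y k))
        / (conj (unitRoot N j) - conj (unitRoot N k)) ^ 2
      = ∑ j, conj (y j) * ∑ k, (conj (x j) - conj (x k))
        / (conj (unitRoot N j) - conj (unitRoot N k)) ^ 2 := by
  rw [← sub_eq_zero]
  simp only [Finset.mul_sum, ← Finset.sum_sub_distrib]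
  have h1 : ∑ j, ∑ k, (conj (y j) * conj (x k))
        / (conj (unitRoot N j) - conj (unitRoot N k)) ^ 2
      = ∑ j, ∑ k, (conj (y k) * conj (x j))
        / (conj (unitRoot N j) - conj (unitRoot N k)) ^ 2 := by
    rw [Finset.sum_comm]
    refine Finset.sum_congr rfl fun j _ => Finset.sum_congr rfl fun k _ => ?_
    rw [← neg_sub, neg_sq]
  rw [← sub_eq_zero] at h1
  simp only [← Finset.sum_sub_distrib] at h1
  rw [← h1]
  refine Finset.sum_congr rfl fun j _ => Finset.sum_congr rfl fun k _ => ?_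
  ring

/-- ⟨x, Ay⟩ is a real combination of Hermitian products, whose real parts are symmetric, plus the
real part of a form `C` bilinear in conj x and conj y. `C` is symmetric because its kernel is even
under j ↔ k. -/
lemma IsPolygonOperator.isRealSymmetric (hA : IsPolygonOperator κ α s A) :
    IsRealSymmetric A := by
  let C : (Option (Fin N) → ℂ) → (Option (Fin N) → ℂ) → ℂ := fun x y =>
    (α : ℂ) * ∑ j, unitRoot N j ^ 2 * (conj (x (some j)) * conj (y (some j)))
    - (s : ℂ) * ∑ j, unitRoot N j ^ 2 *
        ((conj (x (some j)) - conj (x none)) * (conj (y (some j)) - conj (y none)))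
    - (s : ℂ) * ∑ j, conj (x (some j)) * ∑ k, (conj (y (some j)) - conj (y (some k)))
        / (conj (unitRoot N j) - conj (unitRoot N k)) ^ 2
  have hC : ∀ x y, C x y = C y x := by
    intro x y
    simp only [C]
    rw [sum_interaction_symm (fun j => x (some j)) (fun j => y (some j))]
    congr 2
    · congr 1
      exact Finset.sum_congr rfl fun j _ => by ring
    · congr 1
      exact Finset.sum_congr rfl fun j _ => by ring
  have key : ∀ x y, realDot x (A y) = κ * (conj (x none) * y none).re
      + (α - s * (N + 1) / 2) * (∑ j, conj (x (some j)) * y (some j)).re + (C x y).re := by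
    intro x y
    rw [realDot_option, ← Complex.re_ofReal_mul, ← Complex.re_ofReal_mul, ← Complex.add_re,
      ← Complex.add_re]
    congr 1
    rw [hA.apply_none]
    simp only [hA.apply_some, C, Finset.mul_sum, mul_sub, mul_add, ← Finset.sum_sub_distrib]
    rw [sub_add, ← Finset.sum_sub_distrib]
    rw [add_assoc, ← Finset.sum_add_distrib, sub_eq_add_neg, ← Finset.sum_neg_distrib]
    congr 1
    · ring
    · refine Finset.sum_congr rfl fun j _ => ?_
      push_cast
      simp only [← Finset.mul_sum]
      ring
  intro x y
  rw [realDot_comm, key, key, hC]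
  congr 2
  · congr 1
    simp
    ring
  · congr 1
    rw [Complex.re_sum, Complex.re_sum]
    refine Finset.sum_congr rfl fun j _ => ?_
    simp
    ring

/-- The perturbation `a e^{i m θ} + b e^{-i m θ}` of the ring (in the co-rotating frame of each
vertex), together with the displacement `h₀` of the center. -/
def ringMode (N m : ℕ) (a b h₀ : ℂ) : Option (Fin N) → ℂ
  | some j => a * unitRoot N j ^ (m + 1) + b * unitRoot N j ^ (N - m + 1)
  | none => h₀

/-- The antilinear part of A sends mode m to mode -m; N - m represents -m by a natural number. -/
lemma unitRoot_sq_mul_conj_pow (j : Fin N) {m : ℕ} (hm : m ≤ N) :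
    unitRoot N j ^ 2 * conj (unitRoot N j) ^ (m + 1) = unitRoot N j ^ (N - m + 1) := by
  have h1 : unitRoot N j ^ (N - m + 1) * unitRoot N j ^ (m + 1) = unitRoot N j ^ 2 := by
    rw [← pow_add, show N - m + 1 + (m + 1) = N + 2 by omega, pow_add, unitRoot_pow, one_mul]
  have h2 := conj_unitRoot_pow j (m + 1)
  linear_combination (-conj (unitRoot N j) ^ (m + 1)) * h1 + unitRoot N j ^ (N - m + 1) * h2

lemma unitRoot_sq_mul_conj_pow' (j : Fin N) {m : ℕ} (hm : m ≤ N) :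
    unitRoot N j ^ 2 * conj (unitRoot N j) ^ (N - m + 1) = unitRoot N j ^ (m + 1) := by
  have := unitRoot_sq_mul_conj_pow j (Nat.sub_le N m)
  rwa [Nat.sub_sub_self hm] at this

/-- On (a, conj b) the ring acts by the matrix with rows (β, γ), (γ, β). Here β + γ is λ₊*(m) and β
- γ = -s m(N-m)/2; the center excites only E². -/
lemma IsPolygonOperator.apply_ringMode_some (hA : IsPolygonOperator κ α s A) {m : ℕ} (hm : m ≤ N)
    {β γ : ℝ} (hβ : β = α - s * (N + 1) / 2)
    (hγ : γ = α - s * ((1 - (m : ℝ)) * (N - 1 - m) / 2 + 1)) (a b h₀ : ℂ) (j : Fin N) :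
    A (ringMode N m a b h₀) (some j) = (β * a + γ * conj b) * unitRoot N j ^ (m + 1)
      + (β * b + γ * conj a) * unitRoot N j ^ (N - m + 1)
      + s * conj h₀ * unitRoot N j ^ 2 := by
  have h1 := sum_conj_pow_sub_div_sq j m hm
  have h2 := sum_conj_pow_sub_div_sq j (N - m) (Nat.sub_le N m)
  rw [unitRoot_sq_mul_conj_pow j hm] at h1
  rw [unitRoot_sq_mul_conj_pow' j hm] at h2
  push_cast [hm] at h2
  have h3 : ∑ k, (conj (ringMode N m a b h₀ (some j)) - conj (ringMode N m a b h₀ (some k)))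
        / (conj (unitRoot N j) - conj (unitRoot N k)) ^ 2
      = conj a * (unitRoot N j ^ (N - m + 1) * ((1 - (m : ℂ)) * (N - 1 - m) / 2))
        + conj b * (unitRoot N j ^ (m + 1) *
          ((1 - ((N : ℂ) - m)) * (N - 1 - ((N : ℂ) - m)) / 2)) := by
    rw [← h1, ← h2, Finset.mul_sum, Finset.mul_sum, ← Finset.sum_add_distrib]
    refine Finset.sum_congr rfl fun k _ => ?_
    simp only [ringMode, map_add, map_mul, map_pow]
    ring
  have h4 : unitRoot N j ^ 2 * conj (ringMode N m a b h₀ (some j))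
      = conj a * unitRoot N j ^ (N - m + 1) + conj b * unitRoot N j ^ (m + 1) := by
    rw [← unitRoot_sq_mul_conj_pow j hm, ← unitRoot_sq_mul_conj_pow' j hm]
    simp only [ringMode, map_add, map_mul, map_pow]
    rw [unitRoot_sq_mul_conj_pow' j hm]
    linear_combination conj b * unitRoot_sq_mul_conj_pow' j hm
  rw [hA.apply_some, h3, mul_sub (unitRoot N j ^ 2), h4, hβ, hγ]
  simp only [ringMode]
  push_cast
  ring

/-- The center feels a ring mode only when N divides one of the two exponents. The self-term ∑ E²
vanishes for N ≥ 3 but not for N = 2. -/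
lemma IsPolygonOperator.apply_ringMode_none (hA : IsPolygonOperator κ α s A) {m : ℕ} (hm : m ≤ N)
    (a b h₀ : ℂ) :
    A (ringMode N m a b h₀) none = κ * h₀ - s * conj h₀ * ∑ k, unitRoot N k ^ 2
      + s * (conj a * ∑ k, unitRoot N k ^ (N - m + 1)
        + conj b * ∑ k, unitRoot N k ^ (m + 1)) := by
  rw [hA.apply_none]
  simp only [Finset.mul_sum]
  rw [sub_add, ← Finset.sum_add_distrib, Finset.mul_sum, ← Finset.sum_sub_distrib]
  congr 1
  refine Finset.sum_congr rfl fun k _ => ?_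
  rw [← unitRoot_sq_mul_conj_pow k hm, ← unitRoot_sq_mul_conj_pow' k hm]
  simp only [ringMode, map_add, map_mul, map_pow]
  rw [unitRoot_sq_mul_conj_pow' k hm]
  linear_combination (-s * conj b : ℂ) * unitRoot_sq_mul_conj_pow' k hm

/-- The displacement `x` is an infinitesimal rotation of the `N + 1` configuration. -/
def IsInfinitesimalRotation (x : Option (Fin N) → ℂ) : Prop :=
  x none = 0 ∧ ∃ τ : ℝ, ∀ j, x (some j) = Complex.I * τ * unitRoot N j

/-- The matrix coupling the first ring mode to the central vortex. -/
def couplingMatrix (N : ℕ) (κ α s : ℝ) : Matrix (Fin 3) (Fin 3) ℝ :=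
  !![α - s * (N + 1) / 2, α - s, s; α - s, α - s * (N + 1) / 2, 0; s * N, 0, κ]

lemma mem_spectrum_iff_exists_mulVec {n : Type*} [Fintype n] [DecidableEq n]
    {M : Matrix n n ℂ} {μ : ℂ} : μ ∈ spectrum ℂ M ↔ ∃ v ≠ 0, M.mulVec v = μ • v := by
  rw [← Matrix.spectrum_toLin', ← Module.End.hasEigenvalue_iff_mem_spectrum]
  constructor
  · intro h
    obtain ⟨v, hv⟩ := h.exists_hasEigenvector
    exact ⟨v, hv.2, by simpa using hv.apply_eq_smul⟩
  · rintro ⟨v, hv, h⟩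
    exact Module.End.hasEigenvalue_of_hasEigenvector (x := v)
      ⟨Module.End.mem_eigenspace_iff.2 (by simpa using h), hv⟩

end PolygonOperators

/-! ### Sufficiency: Fourier coefficients of an eigenvector -/

noncomputable section Sufficiency

variable {N : ℕ} {κ α s : ℝ} {A : (Option (Fin N) → ℂ) →ₗ[ℝ] (Option (Fin N) → ℂ)}

/-- The discrete Fourier coefficients of the ring component. -/
def fourierCoeff (x : Option (Fin N) → ℂ) (l : ℕ) : ℂ :=
  ∑ j, conj (unitRoot N j) ^ l * x (some j)

/-- Three exponents occur in the image of a ring mode under A: its own pair, and the 2 coming from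
the center. -/
lemma realDot_of_some_eq {y x : Option (Fin N) → ℂ} {a b d : ℂ} {m m' m'' : ℕ}
    (hy : ∀ j, y (some j) = a * unitRoot N j ^ m + b * unitRoot N j ^ m' + d * unitRoot N j ^ m'') :
    realDot y x = (conj a * fourierCoeff x m + conj b * fourierCoeff x m'
      + conj d * fourierCoeff x m'' + conj (y none) * x none).re := by
  rw [realDot_option]
  congr 1
  simp only [hy, fourierCoeff, Finset.mul_sum]
  rw [add_comm, ← Finset.sum_add_distrib, ← Finset.sum_add_distrib]
  congr 1
  refine Finset.sum_congr rfl fun j _ => ?_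
  simp only [map_add, map_mul, map_pow]
  ring

lemma realDot_ringMode (m : ℕ) (a b h₀ : ℂ) (x : Option (Fin N) → ℂ) :
    realDot (ringMode N m a b h₀) x = (conj a * fourierCoeff x (m + 1)
      + conj b * fourierCoeff x (N - m + 1) + conj h₀ * x none).re := by
  rw [realDot_of_some_eq (a := a) (b := b) (d := 0) (m := m + 1) (m' := N - m + 1) (m'' := 0)
    (fun j => by simp [ringMode])]
  simp [ringMode]

/-- Testing an eigenvector against a Fourier mode. -/
lemma IsPolygonOperator.eigenvector_pairing (hA : IsPolygonOperator κ α s A) {l : ℝ}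
    {x : Option (Fin N) → ℂ} (hx : A x = l • x) {m : ℕ} (hm : m ≤ N)
    {β γ : ℝ} (hβ : β = α - s * (N + 1) / 2)
    (hγ : γ = α - s * ((1 - (m : ℝ)) * (N - 1 - m) / 2 + 1)) (a b h₀ : ℂ) :
    (conj (β * a + γ * conj b) * fourierCoeff x (m + 1)
      + conj (β * b + γ * conj a) * fourierCoeff x (N - m + 1)
      + s * h₀ * fourierCoeff x 2
      + conj (κ * h₀ - s * conj h₀ * ∑ k, unitRoot N k ^ 2
        + s * (conj a * ∑ k, unitRoot N k ^ (N - m + 1)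
          + conj b * ∑ k, unitRoot N k ^ (m + 1))) * x none).re
      = l * (conj a * fourierCoeff x (m + 1)
        + conj b * fourierCoeff x (N - m + 1) + conj h₀ * x none).re := by
  rw [← realDot_ringMode, ← realDot_smul_right, ← hx, ← hA.isRealSymmetric,
    realDot_of_some_eq (hA.apply_ringMode_some hm hβ hγ a b h₀), hA.apply_ringMode_none hm]
  simp

lemma eq_zero_of_forall_conj_mul_re {z : ℂ} (h : ∀ a : ℂ, (conj a * z).re = 0) : z = 0 := by
  have h1 := h 1
  have h2 := h Complex.I
  simp at h1 h2
  exact Complex.ext h1 h2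

/-- The test modes b = ± conj a diagonalize the 2×2 block, with eigenvalues β ± γ; if l is not that
eigenvalue, the matching combination of coefficients vanishes. -/
lemma IsPolygonOperator.fourierCoeff_off_resonance (hA : IsPolygonOperator κ α s A) {l : ℝ}
    {x : Option (Fin N) → ℂ} (hx : A x = l • x) {m : ℕ} (hm : m ≤ N)
    (h1 : ¬ N ∣ m + 1) (h2 : ¬ N ∣ N - m + 1) {β γ : ℝ} (hβ : β = α - s * (N + 1) / 2)
    (hγ : γ = α - s * ((1 - (m : ℝ)) * (N - 1 - m) / 2 + 1)) :
    (β + γ - l ≠ 0 → fourierCoeff x (m + 1) + conj (fourierCoeff x (N - m + 1)) = 0) ∧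
    (β - γ - l ≠ 0 → fourierCoeff x (m + 1) - conj (fourierCoeff x (N - m + 1)) = 0) := by
  have key := fun a b => hA.eigenvector_pairing hx hm hβ hγ a b 0
  rw [sum_unitRoot_pow _ h1, sum_unitRoot_pow _ h2] at key
  constructor
  · intro hne
    refine eq_zero_of_forall_conj_mul_re fun a => ?_
    have h := key a (conj a)
    refine (mul_eq_zero.1 (?_ : (β + γ - l) * _ = 0)).resolve_left hne
    simp [-mul_eq_zero] at h ⊢
    linear_combination h
  · intro hne
    refine eq_zero_of_forall_conj_mul_re fun a => ?_
    have h := key a (-conj a)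
    refine (mul_eq_zero.1 (?_ : (β - γ - l) * _ = 0)).resolve_left hne
    simp [-mul_eq_zero] at h ⊢
    linear_combination h

/-- The resonant case m = 1, where E^N = 1 reaches the center. The factor N on the last entry turns
the symmetric pairing equations into the unsymmetric normalization of M₀. -/
lemma IsPolygonOperator.couplingMatrix_mulVec (hA : IsPolygonOperator κ α s A) {l : ℝ}
    {x : Option (Fin N) → ℂ} (hx : A x = l • x) (hN : 3 ≤ N) :
    ((couplingMatrix N κ α s).map (fun a : ℝ => (a : ℂ))).mulVec
        ![fourierCoeff x 2, conj (fourierCoeff x N), N * conj (x none)]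
      = (l : ℂ) • ![fourierCoeff x 2, conj (fourierCoeff x N), N * conj (x none)] := by
  obtain ⟨β, hβ⟩ : ∃ β, β = α - s * (N + 1) / 2 := ⟨_, rfl⟩
  have key := fun a b h => hA.eigenvector_pairing hx (m := 1) (by omega)
    (γ := α - s) hβ (by push_cast; ring) a b h
  have h1 : ∑ k, unitRoot N k ^ 2 = 0 :=
    sum_unitRoot_pow _ (Nat.not_dvd_of_pos_of_lt (by omega) (by omega))
  have h2 : ∑ k, unitRoot N k ^ N = N := by simp [unitRoot_pow]
  rw [show N - 1 + 1 = N by omega, show 1 + 1 = 2 from rfl, h1, h2] at key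
  norm_num at key
  set X := fourierCoeff x 2
  set Y := fourierCoeff x N
  -- Varying each of the three amplitudes alone over ℂ turns the real pairing into three complex
  -- equations.
  have e0 : (β : ℂ) * X + ((α - s : ℝ) : ℂ) * conj Y
      + s * N * conj (x none) - l * X = 0 := by
    refine eq_zero_of_forall_conj_mul_re fun a => ?_
    have := key a 0 0
    simp at this ⊢
    linear_combination this
  have e1 : ((α - s : ℝ) : ℂ) * conj X + (β : ℂ) * Y - l * Y = 0 := by
    refine eq_zero_of_forall_conj_mul_re fun a => ?_
    have := key 0 a 0
    simp at this ⊢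
    linear_combination this
  have e2 : s * conj X + κ * x none - l * x none = 0 := by
    refine eq_zero_of_forall_conj_mul_re fun a => ?_
    have := key 0 0 a
    simp at this ⊢
    linear_combination this
  have e1' := congrArg conj e1
  have e2' := congrArg conj e2
  simp only [map_sub, map_add, map_mul, Complex.conj_conj, Complex.conj_ofReal, map_zero]
    at e1' e2'
  funext i
  fin_cases i
  · simp [couplingMatrix, Matrix.mulVec, dotProduct, Fin.sum_univ_three]
    rw [hβ] at e0
    push_cast at e0
    linear_combination e0
  · simp [couplingMatrix, Matrix.mulVec, dotProduct, Fin.sum_univ_three]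
    rw [hβ] at e1'
    push_cast at e1'
    linear_combination e1'
  · simp [couplingMatrix, Matrix.mulVec, dotProduct, Fin.sum_univ_three]
    linear_combination (N : ℂ) * e2'

/-- Vandermonde with distinct nodes; exponents run over 1, …, N, so one factor is first absorbed
into y. -/
lemma eq_zero_of_fourierCoeff_eq_zero {y : Fin N → ℂ}
    (h : ∀ l < N, ∑ j, conj (unitRoot N j) ^ (l + 1) * y j = 0) : y = 0 := by
  have h1 : (fun j => conj (unitRoot N j) * y j) = 0 := by
    refine Matrix.eq_zero_of_forall_pow_sum_mul_pow_eq_zero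
      (f := fun j => conj (unitRoot N j)) ?_ fun i => ?_
    · exact (starRingEnd ℂ).injective.comp unitRoot_injective
    · rw [← h i i.2]
      exact Finset.sum_congr rfl fun j _ => by ring
  funext j
  exact (mul_eq_zero.1 (congrFun h1 j)).resolve_left ((map_ne_zero _).2 (unitRoot_ne_zero j))

/-- Under the stability criterion, an eigenvector with nonnegative eigenvalue is a rotation. -/
lemma IsPolygonOperator.eigenvector_eq_rotation (hA : IsPolygonOperator κ α s A) {l : ℝ}
    (hl : 0 ≤ l) {x : Option (Fin N) → ℂ} (hx : A x = l • x) (hN : 3 ≤ N) (hs : 0 < s)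
    (hlam : 2 * α + s / 2 * (((N / 2 : ℕ) : ℝ) * (N - (N / 2 : ℕ)) - 2 * N - 2) < 0)
    (hM : AllEigenvaluesNegative (couplingMatrix N κ α s)) :
    IsInfinitesimalRotation x := by
  have hNpos : (0 : ℝ) < N := by exact_mod_cast (by omega : 0 < N)
  have hNc : (N : ℂ) ≠ 0 := by exact_mod_cast hNpos.ne'
  have hlam' : ∀ m ≤ N, 2 * α + s / 2 * ((m : ℝ) * (N - m) - 2 * N - 2) < 0 := by
    intro m hm
    refine lt_of_le_of_lt ?_ hlam
    -- For odd N the bound needs m to be an integer, hence the dichotomy `h2`.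
    have : (m : ℝ) * (N - m) ≤ ((N / 2 : ℕ) : ℝ) * (N - (N / 2 : ℕ)) := by
      obtain ⟨k, hk⟩ : ∃ k, k = N / 2 := ⟨_, rfl⟩
      have h1 : N = 2 * k ∨ N = 2 * k + 1 := by omega
      rw [← hk]
      have h2 : (m : ℝ) ≤ k ∨ (k : ℝ) + 1 ≤ m := by
        rcases Nat.lt_or_ge k m with h | h
        · right; exact_mod_cast h
        · left; exact_mod_cast h
      rcases h1 with h1 | h1
      · have : (N : ℝ) = 2 * k := by exact_mod_cast h1
        rw [this]
        nlinarith [sq_nonneg ((m : ℝ) - k)]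
      · have : (N : ℝ) = 2 * k + 1 := by exact_mod_cast h1
        rw [this]
        rcases h2 with h2 | h2 <;> nlinarith
    have := mul_le_mul_of_nonneg_left this hs.le
    linarith
  have hcoup : fourierCoeff x 2 = 0 ∧ fourierCoeff x N = 0 ∧ x none = 0 := by
    have hv : ![fourierCoeff x 2, conj (fourierCoeff x N), N * conj (x none)] = 0 := by
      by_contra hne
      have := hM l (mem_spectrum_iff_exists_mulVec.2
        ⟨_, hne, hA.couplingMatrix_mulVec hx hN⟩)
      rw [Complex.ofReal_re] at this
      linarith [this.2]
    refine ⟨congrFun hv 0, ?_, ?_⟩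
    · have := congrFun hv 1
      simpa using this
    · have := congrFun hv 2
      simpa [hNc] using this
  have hmid : ∀ m, 1 < m → m + 1 < N → fourierCoeff x (m + 1) = 0 := by
    intro m hm hmN
    have h := hA.fourierCoeff_off_resonance hx (m := m) (by omega)
      (Nat.not_dvd_of_pos_of_lt (by omega) hmN)
      (Nat.not_dvd_of_pos_of_lt (by omega) (by omega)) rfl rfl
    have h1 := hlam' m (by omega)
    have h2 := h.1 (by nlinarith)
    -- This makes β - γ = -s m(N-m)/2 negative, hence different from l ≥ 0.
    have h3 : 0 < s * ((m : ℝ) * (N - m)) := by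
      have h4 : (m : ℝ) < N := by exact_mod_cast (by omega : m < N)
      have h5 : (0 : ℝ) < m := by exact_mod_cast (by omega : 0 < m)
      have h6 : (0 : ℝ) < N - m := by linarith
      positivity
    have h4 := h.2 (by nlinarith)
    linear_combination (h2 + h4) / 2
  -- For m = 0 both exponents are 1 modulo N. β + γ < 0 kills the real part; β - γ = 0 can leave the
  -- imaginary part free, which is the rotation.
  have hfirst : (fourierCoeff x 1).re = 0 := by
    have h3 : ¬ N ∣ N + 1 := by
      intro hd
      have := (Nat.dvd_add_right (dvd_refl N)).1 hd
      have := Nat.le_of_dvd one_pos this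
      omega
    have h := hA.fourierCoeff_off_resonance hx (m := 0) (by omega)
      (Nat.not_dvd_of_pos_of_lt (by omega) (by omega)) h3 rfl rfl
    have h1 := hlam' 0 (by omega)
    have h2 := h.1 (by push_cast at h1 ⊢; nlinarith)
    have h4 : fourierCoeff x (N - 0 + 1) = fourierCoeff x 1 := by
      refine Finset.sum_congr rfl fun j _ => ?_
      rw [Nat.sub_zero, pow_succ, ← map_pow, unitRoot_pow]
      simp
    rw [h4, zero_add, Complex.add_conj] at h2
    have : (2 : ℝ) * (fourierCoeff x 1).re = 0 := by exact_mod_cast h2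
    linarith
  refine ⟨hcoup.2.2, (fourierCoeff x 1).im / N, ?_⟩
  have hτ : fourierCoeff x 1 = N * (Complex.I * ((fourierCoeff x 1).im / N : ℝ)) := by
    push_cast
    field_simp
    apply Complex.ext <;> simp [hfirst]
  have hzero : (fun j => x (some j) - Complex.I * ((fourierCoeff x 1).im / N : ℝ) * unitRoot N j)
      = 0 := by
    refine eq_zero_of_fourierCoeff_eq_zero fun l hlN => ?_
    simp only [mul_sub, Finset.sum_sub_distrib]
    have h1 : ∑ j, conj (unitRoot N j) ^ (l + 1)
          * (Complex.I * ((fourierCoeff x 1).im / N : ℝ) * unitRoot N j)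
        = Complex.I * ((fourierCoeff x 1).im / N : ℝ) * ∑ j, conj (unitRoot N j ^ l) := by
      rw [Finset.mul_sum]
      refine Finset.sum_congr rfl fun j _ => ?_
      rw [map_pow, pow_succ]
      linear_combination (conj (unitRoot N j) ^ l *
        (Complex.I * ((fourierCoeff x 1).im / N : ℝ))) * unitRoot_mul_conj j
    rw [h1]
    change fourierCoeff x (l + 1) - _ = 0
    rcases Nat.eq_zero_or_pos l with rfl | hl0
    · simp only [pow_zero, map_one, Finset.sum_const, Finset.card_univ, Fintype.card_fin,
        nsmul_eq_mul, mul_one, zero_add]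
      linear_combination hτ
    · rw [← map_sum, sum_unitRoot_pow l (Nat.not_dvd_of_pos_of_lt hl0 hlN), map_zero, mul_zero,
        sub_zero]
      rcases Nat.lt_or_ge 1 l with h | h
      · rcases Nat.lt_or_ge (l + 1) N with h' | h'
        · exact hmid l h h'
        · rw [show l + 1 = N by omega]
          exact hcoup.2.1
      · rw [show l + 1 = 2 by omega]
        exact hcoup.1
  intro j
  exact sub_eq_zero.1 (congrFun hzero j)

end Sufficiency

/-! ### Necessity: test vectors for the quadratic form -/

noncomputable section Necessity

variable {N : ℕ} {κ α s : ℝ} {A : (Option (Fin N) → ℂ) →ₗ[ℝ] (Option (Fin N) → ℂ)}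

/-- The operator is negative definite modulo rotations. -/
def IsNegativeModRotations (A : (Option (Fin N) → ℂ) →ₗ[ℝ] (Option (Fin N) → ℂ)) : Prop :=
  ∀ v, realDot v (A v) ≤ 0 ∧ (realDot v (A v) = 0 → IsInfinitesimalRotation v)

lemma unitRoot_zero (hN : 0 < N) : unitRoot N ⟨0, hN⟩ = 1 := by simp [unitRoot]

/-- λ₊*(m) is the Rayleigh quotient of the mode a = b = 1 with the center fixed, so coupling to the
center is harmless. At vertex 0 this mode is real and nonzero, so it is no rotation. -/
lemma IsPolygonOperator.ringMode_eigenvalue_neg (hA : IsPolygonOperator κ α s A)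
    (hneg : IsNegativeModRotations A) (hN : 0 < N) {m : ℕ} (hm : m ≤ N) :
    2 * α + s / 2 * ((m : ℝ) * (N - m) - 2 * N - 2) < 0 := by
  set v := ringMode N m 1 1 0 with hv
  have h1 : realDot v (A v) = (2 * α + s / 2 * ((m : ℝ) * (N - m) - 2 * N - 2)) * realDot v v := by
    rw [realDot_option, realDot_option, ← Complex.re_ofReal_mul]
    congr 1
    have h0 : v none = 0 := rfl
    rw [h0, map_zero, zero_mul, zero_mul, zero_add, zero_add, Finset.mul_sum]
    refine Finset.sum_congr rfl fun j _ => ?_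
    rw [hv, hA.apply_ringMode_some hm rfl rfl]
    simp only [ringMode, map_one, map_zero]
    push_cast
    ring
  by_contra! hpos
  have h2 := hneg v
  have h3 : realDot v (A v) = 0 :=
    le_antisymm h2.1 (h1 ▸ mul_nonneg hpos (realDot_self_nonneg v))
  obtain ⟨-, τ, hτ⟩ := h2.2 h3
  have h4 := hτ ⟨0, hN⟩
  simp only [hv, ringMode, unitRoot_zero] at h4
  have h5 := congrArg Complex.re h4
  norm_num at h5

/-- The quadratic form of the coupling matrix is negative definite. -/
lemma IsPolygonOperator.coupling_form_neg (hA : IsPolygonOperator κ α s A)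
    (hneg : IsNegativeModRotations A) (hN : 2 ≤ N) (a b h : ℝ)
    (hne : ¬ (a = 0 ∧ b = 0 ∧ h = 0)) :
    N * (a * ((α - s * (N + 1) / 2) * a + (α - s) * b + s * h)
      + b * ((α - s) * a + (α - s * (N + 1) / 2) * b)) + h * (s * N * a + κ * h) < 0 := by
  set v := ringMode N 1 a b h with hv
  -- Relative to `v`, the quantities a, conj b and conj h₀ are all multiplied by i. The coupling
  -- terms are invariant under this common phase; the other cross terms change sign and cancel in
  -- the sum, even for N = 2.
  set w := ringMode N 1 (Complex.I * a) (-(Complex.I * b)) (-(Complex.I * h)) with hw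
  have hsum : realDot v (A v) + realDot w (A w) = 2 * (N * (a * ((α - s * (N + 1) / 2) * a
      + (α - s) * b + s * h) + b * ((α - s) * a + (α - s * (N + 1) / 2) * b))
      + h * (s * N * a + κ * h)) := by
    rw [realDot_option, realDot_option, ← Complex.add_re, ← Complex.ofReal_re (2 * _)]
    congr 1
    rw [add_add_add_comm, ← Finset.sum_add_distrib]
    have hring : ∀ j, conj (v (some j)) * A v (some j) + conj (w (some j)) * A w (some j)
        = 2 * (a * ((α - s * (N + 1) / 2) * a + (α - s) * b + s * h)
          + b * ((α - s) * a + (α - s * (N + 1) / 2) * b)) := by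
      intro j
      have h1 : 1 ≤ N := by omega
      rw [hv, hw, hA.apply_ringMode_some h1 (β := α - s * (N + 1) / 2) (γ := α - s) rfl
        (by push_cast; ring), hA.apply_ringMode_some h1 (β := α - s * (N + 1) / 2) (γ := α - s) rfl
        (by push_cast; ring)]
      simp only [ringMode, Nat.sub_add_cancel h1, unitRoot_pow, map_add, map_mul, map_neg, map_pow,
        Complex.conj_I, Complex.conj_ofReal, map_one]
      have h2 := conj_unitRoot_pow j 2
      push_cast
      norm_num
      generalize conj (unitRoot N j) ^ 2 = E' at h2 ⊢
      generalize unitRoot N j ^ 2 = E at h2 ⊢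
      linear_combination (2 * a * ((α - s * (N + 1) / 2) * a + (α - s) * b + s * h)) * h2
        + (-(a * E' - b) * (((α - s * (N + 1) / 2) * a + (α - s) * b + s * h) * E
          - ((α - s) * a + (α - s * (N + 1) / 2) * b))) * Complex.I_sq
    simp only [hring]
    have hnone : conj (v none) * A v none + conj (w none) * A w none
        = 2 * (h * (s * N * a + κ * h)) := by
      have h1 : 1 ≤ N := by omega
      rw [hv, hw, hA.apply_ringMode_none h1, hA.apply_ringMode_none h1]
      simp only [ringMode, Nat.sub_add_cancel h1, unitRoot_pow, map_mul, map_neg,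
        Complex.conj_I, Complex.conj_ofReal, Finset.sum_const, Finset.card_univ, Fintype.card_fin,
        nsmul_eq_mul, mul_one]
      norm_num
      generalize ∑ k, unitRoot N k ^ 2 = S
      linear_combination (h * (-(κ * h) - s * h * S - s * (a * N) + s * b * S) : ℂ)
        * Complex.I_sq
    rw [hnone]
    simp
    ring
  have h1 := hneg v
  have h2 := hneg w
  refine lt_of_le_of_ne (by linarith [h1.1, h2.1]) fun h0 => hne ?_
  rw [h0] at hsum
  obtain ⟨hv0, τ, hτ⟩ := h1.2 (by linarith [h1.1, h2.1])
  obtain ⟨-, σ, hσ⟩ := h2.2 (by linarith [h1.1, h2.1])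
  have hh : h = 0 := by simpa [hv, ringMode] using hv0
  have e1 := hτ ⟨0, by omega⟩
  have e2 := hσ ⟨0, by omega⟩
  have e3 := hσ ⟨1, by omega⟩
  simp only [hv, ringMode, unitRoot_zero] at e1
  simp only [hw, ringMode, unitRoot_zero] at e2
  simp only [hw, ringMode, Nat.sub_add_cancel (by omega : 1 ≤ N), unitRoot_pow] at e3
  have e1' : a + b = 0 := by simpa using congrArg Complex.re e1
  have e2' : a - b = σ := by simpa [sub_eq_add_neg] using congrArg Complex.im e2
  have hE : unitRoot N ⟨1, by omega⟩ ≠ 1 := by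
    rw [← unitRoot_zero (by omega : 0 < N)]
    intro hE
    simpa using unitRoot_injective hE
  have hb : (b : ℂ) = -a := by exact_mod_cast (by linarith : b = -a)
  have hσa : (σ : ℂ) = 2 * a := by exact_mod_cast (by linarith : σ = 2 * a)
  rw [hb, hσa] at e3
  -- Vertex 0 forced b = -a and σ = 2a; at vertex 1 the rotation equation becomes a(E² + 1) = 2aE.
  have e4 : (a : ℂ) * (unitRoot N ⟨1, by omega⟩ - 1) ^ 2 = 0 := by
    refine (mul_eq_zero.1 (?_ : Complex.I * _ = 0)).resolve_left Complex.I_ne_zero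
    linear_combination e3
  have ha : a = 0 := by
    rcases mul_eq_zero.1 e4 with h3 | h3
    · exact_mod_cast h3
    · exact absurd (sub_eq_zero.1 (pow_eq_zero_iff two_ne_zero |>.1 h3)) hE
  exact ⟨ha, by linarith, hh⟩

/-- The matrix is self-adjoint for the inner product with weights (N, N, 1), and the hypothesis is
negativity of the associated form. Pairing a complex eigenvector with itself gives the sign of Re μ
and Im μ = 0. -/
lemma allEigenvaluesNegative_couplingMatrix (hN : 0 < N)
    (hneg : ∀ a b h : ℝ, ¬ (a = 0 ∧ b = 0 ∧ h = 0) →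
      N * (a * ((α - s * (N + 1) / 2) * a + (α - s) * b + s * h)
        + b * ((α - s) * a + (α - s * (N + 1) / 2) * b)) + h * (s * N * a + κ * h) < 0) :
    AllEigenvaluesNegative (couplingMatrix N κ α s) := by
  intro μ hμ
  obtain ⟨v, hv, hMv⟩ := mem_spectrum_iff_exists_mulVec.1 hμ
  have e0 := congrFun hMv 0
  have e1 := congrFun hMv 1
  have e2 := congrFun hMv 2
  simp [couplingMatrix, Matrix.mulVec, dotProduct, Fin.sum_univ_three] at e0 e1 e2
  have hNpos : (0 : ℝ) < N := by exact_mod_cast hN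
  rcases hx : v 0 with ⟨x1, x2⟩
  rcases hy : v 1 with ⟨y1, y2⟩
  rcases hz : v 2 with ⟨z1, z2⟩
  obtain ⟨p, q⟩ := μ
  rw [hx, hy, hz] at e0
  rw [hx, hy] at e1
  rw [hx, hz] at e2
  rw [Complex.ext_iff] at e0 e1 e2
  simp at e0 e1 e2
  obtain ⟨e0r, e0i⟩ := e0
  obtain ⟨e1r, e1i⟩ := e1
  obtain ⟨e2r, e2i⟩ := e2
  have hle : ∀ a b h : ℝ, N * (a * ((α - s * (N + 1) / 2) * a + (α - s) * b + s * h)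
        + b * ((α - s) * a + (α - s * (N + 1) / 2) * b)) + h * (s * N * a + κ * h) ≤ 0 := by
    intro a b h
    by_cases h0 : a = 0 ∧ b = 0 ∧ h = 0
    · obtain ⟨rfl, rfl, rfl⟩ := h0
      simp
    · exact (hneg a b h h0).le
  have hlt : N * (x1 * ((α - s * (N + 1) / 2) * x1 + (α - s) * y1 + s * z1)
        + y1 * ((α - s) * x1 + (α - s * (N + 1) / 2) * y1)) + z1 * (s * N * x1 + κ * z1)
      + (N * (x2 * ((α - s * (N + 1) / 2) * x2 + (α - s) * y2 + s * z2)
        + y2 * ((α - s) * x2 + (α - s * (N + 1) / 2) * y2)) + z2 * (s * N * x2 + κ * z2)) < 0 := by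
    by_cases h1 : x1 = 0 ∧ y1 = 0 ∧ z1 = 0
    · have h2 : ¬ (x2 = 0 ∧ y2 = 0 ∧ z2 = 0) := by
        rintro ⟨rfl, rfl, rfl⟩
        obtain ⟨rfl, rfl, rfl⟩ := h1
        apply hv
        funext i
        fin_cases i
        · exact hx
        · exact hy
        · exact hz
      linarith [hle x1 y1 z1, hneg x2 y2 z2 h2]
    · linarith [hneg x1 y1 z1 h1, hle x2 y2 z2]
  have hre : p * (N * (x1 ^ 2 + x2 ^ 2 + y1 ^ 2 + y2 ^ 2) + z1 ^ 2 + z2 ^ 2) < 0 := by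
    refine lt_of_eq_of_lt ?_ hlt
    linear_combination (-N * x1) * e0r + (-N * x2) * e0i + (-N * y1) * e1r + (-N * y2) * e1i
      - z1 * e2r - z2 * e2i
  have hW : 0 ≤ N * (x1 ^ 2 + x2 ^ 2 + y1 ^ 2 + y2 ^ 2) + z1 ^ 2 + z2 ^ 2 := by positivity
  have hW' : N * (x1 ^ 2 + x2 ^ 2 + y1 ^ 2 + y2 ^ 2) + z1 ^ 2 + z2 ^ 2 ≠ 0 := by
    intro h0
    rw [h0, mul_zero] at hre
    exact lt_irrefl _ hre
  have him : q * (N * (x1 ^ 2 + x2 ^ 2 + y1 ^ 2 + y2 ^ 2) + z1 ^ 2 + z2 ^ 2) = 0 := by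
    linear_combination (N * x2) * e0r - (N * x1) * e0i + (N * y2) * e1r - (N * y1) * e1i
      + z2 * e2r - z1 * e2i
  exact ⟨(mul_eq_zero.1 him).resolve_right hW', by
    by_contra! hp
    exact absurd hre (not_lt.2 (mul_nonneg hp hW))⟩

end Necessity

/-! ### The angular velocity of the relative equilibrium -/

section RelativeEquilibrium

variable {N : ℕ} {f : ℝ → ℝ} {c R : ℝ}

lemma sum_inv_conj_ringPlusCenter (hN : 2 ≤ N) (hR : 0 < R) (j : Option (Fin N)) :
    ∑ k, (conj (ringPlusCenter N R j) - conj (ringPlusCenter N R k))⁻¹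
      = ((N : ℂ) + 1) / (2 * R ^ 2) * ringPlusCenter N R j := by
  have hRc : (R : ℂ) ≠ 0 := by exact_mod_cast hR.ne'
  have hinv : ∀ k : Fin N, (conj (unitRoot N k))⁻¹ = unitRoot N k := fun k =>
    inv_eq_of_mul_eq_one_left (unitRoot_mul_conj k)
  rw [Fintype.sum_option]
  cases j with
  | none =>
    simp only [ringPlusCenter_none, ringPlusCenter_some, map_zero, map_mul, Complex.conj_ofReal,
      zero_sub, sub_zero, inv_zero, zero_add, inv_neg, mul_inv, hinv, Finset.sum_neg_distrib,
      mul_zero]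
    have h := sum_unitRoot_pow (N := N) 1 (Nat.not_dvd_of_pos_of_lt one_pos hN)
    simp only [pow_one] at h
    rw [← Finset.mul_sum, h, mul_zero, neg_zero]
  | some j =>
    simp only [ringPlusCenter_none, ringPlusCenter_some, map_zero, map_mul, Complex.conj_ofReal,
      sub_zero, ← mul_sub, mul_inv, hinv]
    rw [← Finset.mul_sum, sum_inv_conj_sub]
    field_simp
    ring

lemma sum_interaction_ringPlusCenter (hN : 2 ≤ N) (hR : 0 < R) {u : ℂ} (hu : u * conj u = 1)
    (j : Option (Fin N)) :
    ∑ k ∈ Finset.univ.erase j, (u * ringPlusCenter N R j - u * ringPlusCenter N R k)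
        / ((‖u * ringPlusCenter N R j - u * ringPlusCenter N R k‖ ^ 2 : ℝ) : ℂ)
      = ((N : ℂ) + 1) / (2 * R ^ 2) * (u * ringPlusCenter N R j) := by
  rw [mul_left_comm, ← sum_inv_conj_ringPlusCenter hN hR j, Finset.mul_sum,
    ← Finset.add_sum_erase _ _ (Finset.mem_univ j), sub_self, inv_zero, mul_zero, zero_add]
  refine Finset.sum_congr rfl fun k _ => ?_
  rw [div_norm_sq_eq_inv_conj, ← mul_sub, map_mul, mul_inv, map_sub,
    inv_eq_of_mul_eq_one_left hu]

/-- At the center the factor 0 makes f(0) irrelevant, so one ω serves all vortices. -/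
lemma apply_norm_mul_ringPlusCenter (hR : 0 < R) {u : ℂ} (hu : ‖u‖ = 1) (j : Option (Fin N)) :
    (f ‖u * ringPlusCenter N R j‖ : ℂ) * (u * ringPlusCenter N R j)
      = f R * (u * ringPlusCenter N R j) := by
  cases j with
  | none => simp [ringPlusCenter_none]
  | some j => rw [norm_mul, hu, one_mul, norm_ringPlusCenter_some hR]

lemma vortexField_rotated_ringPlusCenter (hN : 2 ≤ N) (hR : 0 < R) {u : ℂ} (hu : ‖u‖ = 1)
    (j : Option (Fin N)) :
    vortexField f c (fun k => u * ringPlusCenter N R k) j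
      = Complex.I * ((f R + c / (2 * R ^ 2) * ((N : ℝ) + 1) : ℝ) : ℂ)
        * (u * ringPlusCenter N R j) := by
  have hu' : u * conj u = 1 := by
    rw [Complex.mul_conj, Complex.normSq_eq_norm_sq, hu]
    simp
  simp only [vortexField]
  rw [sum_interaction_ringPlusCenter hN hR hu', mul_assoc Complex.I (f _ : ℂ),
    apply_norm_mul_ringPlusCenter hR hu]
  push_cast
  ring

lemma isVortexSolution_rotatingRingPlusCenter_iff (hN : 2 ≤ N) (hR : 0 < R) (ω : ℝ) :
    IsVortexSolution f c (rotatingRingPlusCenter N R ω) ↔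
      ω = f R + c / (2 * R ^ 2) * ((N : ℝ) + 1) := by
  have hnorm : ∀ t : ℝ, ‖Complex.exp (Complex.I * (ω : ℂ) * (t : ℂ))‖ = 1 := fun t => by
    rw [mul_assoc, mul_comm, ← Complex.ofReal_mul, Complex.norm_exp_ofReal_mul_I]
  have hderiv : ∀ (t : ℝ) (j : Option (Fin N)),
      HasDerivAt (fun r : ℝ => rotatingRingPlusCenter N R ω r j)
        (Complex.I * ω * rotatingRingPlusCenter N R ω t j) t := by
    intro t j
    have h1 : HasDerivAt (fun r : ℝ => Complex.I * (ω : ℂ) * (r : ℂ)) (Complex.I * ω * 1) t :=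
      (Complex.ofRealCLM.hasDerivAt (x := t)).const_mul _
    have h2 := (h1.cexp).mul_const (ringPlusCenter N R j)
    refine h2.congr_deriv ?_
    simp only [rotatingRingPlusCenter]
    ring
  have hfield : ∀ (t : ℝ) (j : Option (Fin N)),
      vortexField f c (rotatingRingPlusCenter N R ω t) j
        = Complex.I * ((f R + c / (2 * R ^ 2) * ((N : ℝ) + 1) : ℝ) : ℂ)
          * rotatingRingPlusCenter N R ω t j := fun t j =>
    vortexField_rotated_ringPlusCenter hN hR (hnorm t) j
  constructor
  · intro h
    have h1 := (hderiv 0 (some ⟨0, by omega⟩)).unique (h 0 (some ⟨0, by omega⟩))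
    rw [hfield] at h1
    have hne : rotatingRingPlusCenter N R ω 0 (some ⟨0, by omega⟩) ≠ 0 := by
      simp only [rotatingRingPlusCenter]
      refine mul_ne_zero (Complex.exp_ne_zero _) ?_
      rw [← norm_ne_zero_iff, norm_ringPlusCenter_some hR]
      exact hR.ne'
    exact_mod_cast mul_left_cancel₀ Complex.I_ne_zero (mul_right_cancel₀ hne h1)
  · rintro h t j
    rw [hfield, ← h]
    exact hderiv t j

lemma aggregationField_ringPlusCenter (hN : 2 ≤ N) (hR : 0 < R) {ω : ℝ}
    (hω : ω = f R + c / (2 * R ^ 2) * ((N : ℝ) + 1)) :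
    aggregationField f c ω (ringPlusCenter N R) = 0 := by
  funext j
  have h1 := sum_interaction_ringPlusCenter hN hR (u := 1) (by simp) j
  have h2 := apply_norm_mul_ringPlusCenter (f := f) hR (u := 1) (by simp) j
  simp only [one_mul] at h1 h2
  simp only [aggregationField, Pi.zero_apply]
  rw [h1, hω]
  push_cast
  linear_combination h2

lemma rotatingVortexField_eq {ι : Type*} [Fintype ι] [DecidableEq ι] (f : ℝ → ℝ) (c ω : ℝ) :
    rotatingVortexField (ι := ι) f c ω = Complex.I • aggregationField f c ω := by
  funext x j
  simp only [rotatingVortexField, vortexField, aggregationField, Pi.smul_apply, smul_eq_mul]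
  push_cast
  ring

end RelativeEquilibrium

/-! ### From spectral conditions to the stability criterion -/

section Stability

variable {N : ℕ} {κ α s : ℝ}

lemma isInfinitesimalRotation_iff_mem_span {R : ℝ} (hR : 0 < R) {v : Option (Fin N) → ℂ} :
    IsInfinitesimalRotation v ↔ v ∈ Submodule.span ℝ {rotationMode (ringPlusCenter N R)} := by
  have hRc : (R : ℂ) ≠ 0 := by exact_mod_cast hR.ne'
  rw [Submodule.mem_span_singleton]
  constructor
  · rintro ⟨h0, τ, hτ⟩
    refine ⟨τ / R, funext fun j => ?_⟩
    cases j with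
    | none => simp [rotationMode, ringPlusCenter_none, h0]
    | some j =>
      simp only [rotationMode, Pi.smul_apply, Complex.real_smul, ringPlusCenter_some, hτ]
      push_cast
      field_simp
  · rintro ⟨r, rfl⟩
    refine ⟨by simp [rotationMode, ringPlusCenter_none], r * R, fun j => ?_⟩
    simp only [rotationMode, Pi.smul_apply, Complex.real_smul, ringPlusCenter_some]
    push_cast
    ring

lemma IsPolygonOperator.apply_infinitesimalRotation
    {A : (Option (Fin N) → ℂ) →ₗ[ℝ] (Option (Fin N) → ℂ)} (hA : IsPolygonOperator κ α s A)
    (hN : 2 ≤ N) {v : Option (Fin N) → ℂ} (hv : IsInfinitesimalRotation v) : A v = 0 := by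
  obtain ⟨h0, τ, hτ⟩ := hv
  have hv' : v = ringMode N 0 (Complex.I * τ) 0 0 := by
    funext j
    cases j with
    | none => exact h0
    | some j => simp [ringMode, hτ]
  rw [hv']
  funext j
  cases j with
  | none =>
    have h1 : ¬ N ∣ N - 0 + 1 := by
      intro hd
      have := (Nat.dvd_add_right (dvd_refl N)).1 hd
      have := Nat.le_of_dvd one_pos this
      omega
    rw [hA.apply_ringMode_none (Nat.zero_le N), sum_unitRoot_pow _ h1]
    simp
  | some j =>
    rw [hA.apply_ringMode_some (Nat.zero_le N) rfl rfl]
    simp only [Nat.sub_zero, pow_succ, unitRoot_pow]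
    simp
    ring

variable {F : (Option (Fin N) → ℂ) → (Option (Fin N) → ℂ)} {R : ℝ}
  {A : (Option (Fin N) → ℂ) →L[ℝ] (Option (Fin N) → ℂ)}

/-- By symmetry the spectral bound makes the form nonpositive, with null vectors in the kernel;
simplicity of 0 makes the kernel the rotation line. Both necessity and (c) use stability in this
form. -/
lemma IsLinearlyStable.isNegativeModRotations (hR : 0 < R)
    (hA : HasFDerivAt F A (ringPlusCenter N R))
    (hsymm : IsRealSymmetric (A : (Option (Fin N) → ℂ) →ₗ[ℝ] (Option (Fin N) → ℂ)))
    (h : IsLinearlyStable F (ringPlusCenter N R)) :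
    IsNegativeModRotations (A : (Option (Fin N) → ℂ) →ₗ[ℝ] (Option (Fin N) → ℂ)) := by
  obtain ⟨-, B, hB, hev, hker⟩ := h
  obtain rfl := hA.unique hB
  rw [hsymm.maxGenEigenspace_zero] at hker
  intro v
  have h1 := hsymm.realDot_apply_self_nonpos (fun l v hv hl => ?_) v
  · refine ⟨h1.1, fun h0 => ?_⟩
    rw [isInfinitesimalRotation_iff_mem_span hR, ← hker]
    exact LinearMap.mem_ker.2 (h1.2 h0)
  · rcases hev l (isComplexEigenvalue_of_apply_eq_smul hv hl) with h2 | h2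
    · exact (Complex.ofReal_re l ▸ h2).le
    · exact (Complex.ofReal_eq_zero.1 h2).le

lemma isLinearlyStable_of_criterion (hN : 3 ≤ N) (hR : 0 < R) (hs : 0 < s)
    (hF : F (ringPlusCenter N R) = 0) (hA : HasFDerivAt F A (ringPlusCenter N R))
    (hpoly : IsPolygonOperator κ α s (A : (Option (Fin N) → ℂ) →ₗ[ℝ] (Option (Fin N) → ℂ)))
    (hlam : 2 * α + s / 2 * (((N / 2 : ℕ) : ℝ) * (N - (N / 2 : ℕ)) - 2 * N - 2) < 0)
    (hM : AllEigenvaluesNegative (couplingMatrix N κ α s)) :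
    IsLinearlyStable F (ringPlusCenter N R) := by
  refine ⟨hF, A, hA, fun μ hμ => ?_, ?_⟩
  · obtain ⟨him, v, hv, hAv⟩ := hpoly.isRealSymmetric.exists_eigenvector hμ
    rcases lt_or_ge μ.re 0 with h | h
    · exact Or.inl h
    · right
      have h1 := hpoly.apply_infinitesimalRotation (by omega)
        (hpoly.eigenvector_eq_rotation h hAv hN hs hlam hM)
      rw [hAv] at h1
      exact Complex.ext ((smul_eq_zero.1 h1).resolve_right hv) him
  · rw [hpoly.isRealSymmetric.maxGenEigenspace_zero]
    ext v
    rw [← isInfinitesimalRotation_iff_mem_span hR, LinearMap.mem_ker]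
    refine ⟨fun h => ?_, fun h => hpoly.apply_infinitesimalRotation (by omega) h⟩
    exact hpoly.eigenvector_eq_rotation le_rfl (by rw [h, zero_smul]) hN hs hlam hM

lemma lambdaPlusStar_eq (f : ℝ → ℝ) (c R : ℝ) (N m : ℕ) :
    lambdaPlusStar f c R N m = 2 * (deriv f R * R / 2)
      + c / R ^ 2 / 2 * ((m : ℝ) * (N - m) - 2 * N - 2) := by
  simp only [lambdaPlusStar, lambdaPlus]
  ring

lemma M0_eq_couplingMatrix {f : ℝ → ℝ} {c R ω : ℝ}
    (hω : ω = f R + c / (2 * R ^ 2) * ((N : ℝ) + 1)) :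
    M0 f c R N = couplingMatrix N (f 0 - ω) (deriv f R * R / 2) (c / R ^ 2) := by
  ext i j
  fin_cases i <;> fin_cases j <;> simp [M0, couplingMatrix, hω] <;> ring

end Stability

end Vortex

theorem theorem3 (N : ℕ) (hN : 2 ≤ N) (f : ℝ → ℝ) (c R : ℝ) (hc : 0 < c) (hR : 0 < R)
    (hf0 : ContinuousWithinAt f (Set.Ici 0) 0) (hfR : DifferentiableAt ℝ f R) :
    (∀ ω : ℝ, Vortex.IsVortexSolution f c (Vortex.rotatingRingPlusCenter N R ω) ↔
      ω = f R + c / (2 * R ^ 2) * ((N : ℝ) + 1)) ∧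
    ∀ ω : ℝ, ω = f R + c / (2 * R ^ 2) * ((N : ℝ) + 1) →
      (3 ≤ N →
        (Vortex.IsLinearlyStable (Vortex.aggregationField f c ω) (Vortex.ringPlusCenter N R) ↔
          Vortex.StabilityCriterion f c R N)) ∧
      (N = 2 →
        Vortex.IsLinearlyStable (Vortex.aggregationField f c ω) (Vortex.ringPlusCenter N R) →
          Vortex.StabilityCriterion f c R N) ∧
      (Vortex.IsLinearlyStable (Vortex.aggregationField f c ω) (Vortex.ringPlusCenter N R) →
        Vortex.IsNeutrallyStable (Vortex.rotatingVortexField f c ω)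
          (Vortex.ringPlusCenter N R)) := by
  refine ⟨Vortex.isVortexSolution_rotatingRingPlusCenter_iff hN hR, fun ω hω => ?_⟩
  obtain ⟨A, hA, hnone, hsome⟩ :=
    Vortex.exists_hasFDerivAt_aggregationField (N := N) (c := c) hR hf0 hfR ω
  have hF := Vortex.aggregationField_ringPlusCenter hN hR hω
  have hpoly : Vortex.IsPolygonOperator (f 0 - ω) (deriv f R * R / 2) (c / R ^ 2)
      (A : (Option (Fin N) → ℂ) →ₗ[ℝ] (Option (Fin N) → ℂ)) := by
    constructor
    · intro h
      rw [ContinuousLinearMap.coe_coe, hnone]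
      push_cast
      rfl
    · intro h j
      -- The equilibrium value of ω eliminates f(R) from the ring equations.
      have hρ : (f R - ω : ℂ) = -((c / R ^ 2 : ℝ) * ((N : ℂ) + 1) / 2) := by
        rw [hω]
        push_cast
        ring
      rw [ContinuousLinearMap.coe_coe, hsome, hρ]
      push_cast
      rfl
  have hneg := fun h => Vortex.IsLinearlyStable.isNegativeModRotations hR hA hpoly.isRealSymmetric h
  have hnec : Vortex.IsLinearlyStable (Vortex.aggregationField f c ω)
      (Vortex.ringPlusCenter N R) → Vortex.StabilityCriterion f c R N := by
    intro h
    refine ⟨?_, ?_⟩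
    · rw [Vortex.lambdaPlusStar_eq]
      exact hpoly.ringMode_eigenvalue_neg (hneg h) (by omega) (Nat.div_le_self N 2)
    · rw [Vortex.M0_eq_couplingMatrix hω]
      exact Vortex.allEigenvaluesNegative_couplingMatrix (by omega)
        (hpoly.coupling_form_neg (hneg h) hN)
  refine ⟨fun hN3 => ⟨hnec, fun hcrit => ?_⟩, fun _ => hnec, fun h => ?_⟩
  · obtain ⟨hlam, hM⟩ := hcrit
    rw [Vortex.lambdaPlusStar_eq] at hlam
    rw [Vortex.M0_eq_couplingMatrix hω] at hM
    exact Vortex.isLinearlyStable_of_criterion hN3 hR (by positivity) hF hA hpoly hlam hM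
  · have hn := hneg h
    rw [Vortex.rotatingVortexField_eq]
    refine ⟨by rw [Pi.smul_apply, hF, smul_zero], Complex.I • A, hA.const_smul Complex.I,
      fun μ hμ => ?_⟩
    exact hpoly.isRealSymmetric.re_eq_zero_of_isComplexEigenvalue
      (fun v => ⟨(hn v).1, fun h0 =>
        hpoly.apply_infinitesimalRotation hN ((hn v).2 h0)⟩)
      (fun v j => rfl) hμ
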